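/- Let $K$ be a field of characteristic zero and let $G$ be an oriented graph (loops allowed) with a finite, nonempty set of vertices $I$; write $i\to j$ if there is an edge from $i$ to $j$ ("$j$ is a direct descendant of $i$, $i$ a direct ascendant of $j$"), and $i\xrightarrow{n}j$ if there is an oriented path with $n$ edges from $i$ to $j$. Let $A_G$ be the associative, non-unitary $K$-algebra generated by $P_i(1)$, $i\in I$, with the relations: $P_j(1)P_i(1)=0$ if $j$ is not a direct descendant of $i$; and $P_{i_n}(1)\cdots P_{i_2}(1)P_{i_1}(1)=P_{i'_n}(1)\cdots P_{i'_2}(1)P_{i_1}(1)$ whenever $i_1\to i_2\to\cdots\to i_n$ and $i_1\to i'_2\to\cdots\to i'_n$. For $i\in I$ and $n\ge 1$ put $P_i(n)=P_{i_n}(1)\cdots P_{i_2}(1)P_i(1)$ for any oriented path $i\to i_2\to\cdots\to i_n$, and $P_i(n)=0$ if there is no such path. Let $\mathcal H_I$ be the polynomial algebra on rooted trees decorated by $I$, with the coproduct $\Delta(t)=\sum_c P^c(t)\otimes R^c(t)$ over admissible cuts; it is a Hopf algebra, graded by the number of vertices. Let $B^+_i:\mathcal H_I\to\mathcal H_I$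 be the grafting of forests on a root decorated by $i$. For non-constant formal series $F_i\in K[[h_j, j\in I]]$, $i\in I$, the associated system of Dyson-Schwinger equations (SDSE) is $X_i=B^+_i(F_i(X_j,j\in I))$, $i\in I$, with unknowns $X_i$ in the completion $\prod_n\mathcal H_I(n)$. It is called Hopf if the subalgebra $\mathcal H_{(S)}$ of $\mathcal H_I$ generated by the homogeneous components $X_i(n)$ of its solution is a Hopf subalgebra, that is, $\Delta(\mathcal H_{(S)})\subseteq\mathcal H_{(S)}\otimes\mathcal H_{(S)}$. In that case $\mathfrak g_{(S)}$ denotes the space of primitive elements of the graded dual of $\mathcal H_{(S)}$, with the pre-Lie product $\star$ determined by $(f\star g)(x)=(f\otimes g)\circ(\pi\otimes\pi)\circ\Delta(x)$ for $x$ in the span of the $X_i(n)$, where $\pi$ is the projection on the span of the trees which vanishes on the forests which are not trees. 1. The following conditions are equivalent: (a) the family $(P_i(n))_{i\in I,\,n\ge1}$ is a basis of $A_G$; (b) all the $P_i(n)$, $i\in I$, $n\ge 1$, are nonzero; (c) every vertex of $G$ has a direct descendant, and any two vertices with a common direct ascendant have the same direct descendants; (d) the series $F_i=1+\sum_{i\to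 j}h_j$, $i\in I$, are non-constant and the SDSE associated to them is Hopf. 2. If these conditions hold, then $A_G$ is generated by the $P_i(1)$, $i\in I$, with the relations $P_j(1)P_i(1)=0$ if $j$ is not a direct descendant of $i$, and $P_j(1)P_i(1)=P_k(1)P_i(1)$ if $i\to j$ and $i\to k$. The product of $A_G$ is given, for $i,j\in I$ and $m,n\ge1$, by $P_j(n)P_i(m)=P_i(m+n)$ if $i\xrightarrow{m}j$, and $P_j(n)P_i(m)=0$ otherwise. Moreover, if $(S)$ is the SDSE of condition (d), then $(\mathfrak g_{(S)},\star)$ is associative and isomorphic to $A_G$ as an algebra. -/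

import Mathlib

open scoped TensorProduct

noncomputable section

/-! ### Associative, non-unitary algebras by generators and relations -/

/-- The free associative, non-unitary `K`-algebra on a set `I`: the semigroup algebra of the
free semigroup (nonempty words) on `I`. -/
abbrev FreeNU (K I : Type*) [Field K] : Type _ := MonoidAlgebra K (FreeSemigroup I)

/-- The generator of the free non-unitary algebra attached to `i`. -/
def FreeNU.gen (K : Type*) {I : Type*} [Field K] (i : I) : FreeNU K I :=
  MonoidAlgebra.single (FreeSemigroup.of i) 1

/-- The congruence of non-unitary `K`-algebras generated by a relation `r`. -/
inductive PresRel {K I : Type*} [Field K] (r : FreeNU K I → FreeNU K I → Prop) :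
    FreeNU K I → FreeNU K I → Prop
  | of {x y} : r x y → PresRel r x y
  | refl (x) : PresRel r x x
  | symm {x y} : PresRel r x y → PresRel r y x
  | trans {x y z} : PresRel r x y → PresRel r y z → PresRel r x z
  | add {x x' y y'} : PresRel r x x' → PresRel r y y' → PresRel r (x + y) (x' + y')
  | mul {x x' y y'} : PresRel r x x' → PresRel r y y' → PresRel r (x * y) (x' * y')
  | smul (c : K) {x x'} : PresRel r x x' → PresRel r (c • x) (c • x')

/-- `PresRel` as a ring congruence. -/
def presCon {K I : Type*} [Field K] (r : FreeNU K I → FreeNU K I → Prop) :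
    RingCon (FreeNU K I) where
  r := PresRel r
  iseqv := ⟨PresRel.refl, PresRel.symm, PresRel.trans⟩
  add' := PresRel.add
  mul' := PresRel.mul

/-- The associative, non-unitary `K`-algebra generated by `I` with the relations `x = y` for
`r x y`. -/
def PresAlg {K I : Type*} [Field K] (r : FreeNU K I → FreeNU K I → Prop) : Type _ :=
  (presCon r).Quotient

namespace PresAlg

variable {K I : Type*} [Field K] (r : FreeNU K I → FreeNU K I → Prop)

instance : NonUnitalRing (PresAlg r) := inferInstanceAs (NonUnitalRing (presCon r).Quotient)

/-- The quotient map from the free non-unitary algebra. -/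
def mk (x : FreeNU K I) : PresAlg r := RingCon.toQuotient (c := presCon r) x

theorem mk_surjective : Function.Surjective (mk r) := fun x => Quotient.exists_rep x

theorem mk_add (x y : FreeNU K I) : mk r (x + y) = mk r x + mk r y := rfl

theorem mk_mul (x y : FreeNU K I) : mk r (x * y) = mk r x * mk r y := rfl

theorem mk_zero : mk r 0 = 0 := rfl

theorem mk_eq_mk {x y : FreeNU K I} : mk r x = mk r y ↔ PresRel r x y :=
  (presCon r).eq

instance : SMul K (PresAlg r) where
  smul c := Quotient.map' (c • ·) fun _ _ h => PresRel.smul c h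

theorem mk_smul (c : K) (x : FreeNU K I) : mk r (c • x) = c • mk r x := rfl

instance : Module K (PresAlg r) where
  one_smul x := by
    obtain ⟨x, rfl⟩ := mk_surjective r x
    rw [← mk_smul, one_smul]
  mul_smul a b x := by
    obtain ⟨x, rfl⟩ := mk_surjective r x
    simp only [← mk_smul, mul_smul]
  smul_zero a := by rw [← mk_zero r, ← mk_smul, smul_zero]
  smul_add a x y := by
    obtain ⟨x, rfl⟩ := mk_surjective r x
    obtain ⟨y, rfl⟩ := mk_surjective r y
    simp only [← mk_smul, ← mk_add, smul_add]
  add_smul a b x := by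
    obtain ⟨x, rfl⟩ := mk_surjective r x
    simp only [← mk_smul, ← mk_add, add_smul]
  zero_smul x := by
    obtain ⟨x, rfl⟩ := mk_surjective r x
    rw [← mk_smul, zero_smul, mk_zero]

instance : IsScalarTower K (PresAlg r) (PresAlg r) where
  smul_assoc a x y := by
    obtain ⟨x, rfl⟩ := mk_surjective r x
    obtain ⟨y, rfl⟩ := mk_surjective r y
    simp only [smul_eq_mul, ← mk_smul, ← mk_mul, smul_mul_assoc]

instance : SMulCommClass K (PresAlg r) (PresAlg r) where
  smul_comm a x y := by
    obtain ⟨x, rfl⟩ := mk_surjective r x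
    obtain ⟨y, rfl⟩ := mk_surjective r y
    simp only [smul_eq_mul, ← mk_smul, ← mk_mul, mul_smul_comm]

/-- The generator attached to `i`. -/
def gen (i : I) : PresAlg r := mk r (FreeNU.gen K i)

end PresAlg

/-! ### The algebra of an oriented graph -/

/-- `pathProd g i [i₂, …, iₙ] = g iₙ ⋯ g i₂ * g i`. -/
def pathProd {I A : Type*} [Mul A] (g : I → A) : I → List I → A
  | i, [] => g i
  | i, j :: l => pathProd g j l * g i

/-- There is an oriented path of length `n` (that is, with `n` edges) from `i` to `j`. -/
def HasPath {I : Type*} (G : Digraph I) : ℕ → I → I → Prop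
  | 0, i, j => i = j
  | n + 1, i, j => ∃ k, G.Adj i k ∧ HasPath G n k j

/-- The relations defining `A_G`. The condition `List.IsChain G.Adj (i :: l)` says that
`i :: l` is an oriented path in `G`. -/
inductive GraphRel (K : Type*) {I : Type*} [Field K] (G : Digraph I) :
    FreeNU K I → FreeNU K I → Prop
  | zero {i j : I} : ¬ G.Adj i j → GraphRel K G (FreeNU.gen K j * FreeNU.gen K i) 0
  | path {i : I} {l l' : List I} : l.length = l'.length →
      List.IsChain G.Adj (i :: l) → List.IsChain G.Adj (i :: l') →
      GraphRel K G (pathProd (FreeNU.gen K) i l) (pathProd (FreeNU.gen K) i l')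

/-- The relations of the simplified presentation. -/
inductive SimpleGraphRel (K : Type*) {I : Type*} [Field K] (G : Digraph I) :
    FreeNU K I → FreeNU K I → Prop
  | zero {i j : I} : ¬ G.Adj i j → SimpleGraphRel K G (FreeNU.gen K j * FreeNU.gen K i) 0
  | edge {i j k : I} : G.Adj i j → G.Adj i k →
      SimpleGraphRel K G (FreeNU.gen K j * FreeNU.gen K i) (FreeNU.gen K k * FreeNU.gen K i)

/-- The algebra `A_G`. -/
abbrev GraphAlg (K : Type*) {I : Type*} [Field K] (G : Digraph I) : Type _ :=
  PresAlg (GraphRel K G)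

open Classical in
/-- The element `P_i(n)` of `A_G`, for `n ≥ 1`: the product of the generators along any oriented
path with `n` vertices starting at `i`, and `0` if there is no such path. -/
def GraphAlg.P (K : Type*) {I : Type*} [Field K] (G : Digraph I) (i : I) (n : ℕ) :
    GraphAlg K G :=
  if h : ∃ l : List I, l.length + 1 = n ∧ List.IsChain G.Adj (i :: l) then
    pathProd (PresAlg.gen (GraphRel K G)) i h.choose
  else 0

theorem PresAlg.mk_pathProd {K I : Type*} [Field K] (r : FreeNU K I → FreeNU K I → Prop)
    (i : I) (l : List I) :
    PresAlg.mk r (pathProd (FreeNU.gen K) i l) = pathProd (PresAlg.gen r) i l := by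
  induction l generalizing i with
  | nil => rfl
  | cons j l ih => simp only [pathProd, PresAlg.mk_mul, ih]; rfl

/-- `P_i(n)` does not depend on the choice of the path. -/
theorem GraphAlg.P_eq (K : Type*) {I : Type*} [Field K] (G : Digraph I) (i : I) (l : List I)
    (hl : List.IsChain G.Adj (i :: l)) :
    GraphAlg.P K G i (l.length + 1) = pathProd (PresAlg.gen (GraphRel K G)) i l := by
  have h : ∃ l' : List I, l'.length + 1 = l.length + 1 ∧ List.IsChain G.Adj (i :: l') :=
    ⟨l, rfl, hl⟩
  rw [GraphAlg.P, dif_pos h, ← PresAlg.mk_pathProd, ← PresAlg.mk_pathProd, PresAlg.mk_eq_mk]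
  exact PresRel.of (GraphRel.path (by have := h.choose_spec.1; omega) h.choose_spec.2 hl)

/-! ### Decorated rooted trees -/

/-- Planar rooted trees decorated by `D`: a root with its decoration and the list of the
subtrees attached to it. -/
inductive PTree (D : Type*)
  | node : D → List (PTree D) → PTree D

/-- Isomorphism of decorated rooted trees: the smallest equivalence relation that allows
permuting the subtrees at any vertex. -/
inductive PTree.Iso {D : Type*} : PTree D → PTree D → Prop
  | perm (d : D) {l l' : List (PTree D)} : l.Perm l' → Iso (.node d l) (.node d l')
  | child (d : D) {t t' : PTree D} (l : List (PTree D)) : Iso t t' →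
      Iso (.node d (t :: l)) (.node d (t' :: l))
  | symm {t t' : PTree D} : Iso t t' → Iso t' t
  | trans {t t' t'' : PTree D} : Iso t t' → Iso t' t'' → Iso t t''

theorem PTree.Iso.refl {D : Type*} : ∀ t : PTree D, PTree.Iso t t
  | .node d _ => .perm d (List.Perm.refl _)

instance PTree.setoid (D : Type*) : Setoid (PTree D) :=
  ⟨PTree.Iso, PTree.Iso.refl, PTree.Iso.symm, PTree.Iso.trans⟩

/-- Rooted trees decorated by `D`. -/
def RTree (D : Type*) : Type _ := Quotient (PTree.setoid D)

/-- The rooted tree underlying a planar tree. -/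
def RTree.mk {D : Type*} (t : PTree D) : RTree D := Quotient.mk _ t

theorem RTree.mk_surjective {D : Type*} : Function.Surjective (RTree.mk (D := D)) :=
  fun x => Quotient.exists_rep x

/-- A planar tree representing a rooted tree. -/
def RTree.out {D : Type*} (t : RTree D) : PTree D := Quotient.out t

theorem RTree.mk_out {D : Type*} (t : RTree D) : RTree.mk t.out = t := Quotient.out_eq t

theorem RTree.out_mk {D : Type*} (t : PTree D) : PTree.Iso (RTree.mk t).out t :=
  Quotient.mk_out (s := PTree.setoid D) t

/-- The number of vertices of a planar tree. -/
def PTree.weight {D : Type*} : PTree D → ℕ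
  | .node _ l => 1 + (l.map PTree.weight).sum

theorem PTree.weight_node {D : Type*} (d : D) (l : List (PTree D)) :
    PTree.weight (.node d l) = 1 + (l.map PTree.weight).sum := by
  rw [PTree.weight]

theorem PTree.weight_congr {D : Type*} {t t' : PTree D} (h : PTree.Iso t t') :
    t.weight = t'.weight := by
  induction h with
  | perm d h => simp only [PTree.weight_node, (h.map PTree.weight).sum_eq]
  | child d l _ ih => simp only [PTree.weight_node, List.map_cons, List.sum_cons, ih]
  | symm _ ih => exact ih.symm
  | trans _ _ ih ih' => exact ih.trans ih'

/-- The weight of a rooted tree: its number of vertices. -/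
def RTree.weight {D : Type*} : RTree D → ℕ :=
  Quotient.lift PTree.weight fun _ _ h => PTree.weight_congr h

/-- `RTree.graft d {t₁, …, tₙ}` is the tree obtained by grafting `t₁, …, tₙ` on a common root
decorated by `d`. -/
def RTree.graft {D : Type*} (d : D) (s : Multiset (RTree D)) : RTree D :=
  RTree.mk (.node d (s.toList.map RTree.out))

theorem PTree.Iso.of_forall₂ {D : Type*} (d : D) {l l' : List (PTree D)}
    (h : List.Forall₂ PTree.Iso l l') (k : List (PTree D)) :
    PTree.Iso (.node d (l ++ k)) (.node d (l' ++ k)) := by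
  induction h generalizing k with
  | nil => exact .refl _
  | @cons a b l₁ l₂ hab _ ih =>
    refine .trans (.child d _ hab) ?_
    refine .trans (.perm d (List.perm_middle.symm : (b :: (l₁ ++ k)).Perm (l₁ ++ b :: k))) ?_
    exact .trans (ih (b :: k)) (.perm d List.perm_middle)

theorem RTree.graft_coe {D : Type*} (d : D) (l : List (PTree D)) :
    RTree.graft d (↑(l.map RTree.mk) : Multiset (RTree D)) = RTree.mk (.node d l) := by
  apply Quotient.sound
  have hp : ((↑(l.map RTree.mk) : Multiset (RTree D)).toList).Perm (l.map RTree.mk) := by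
    rw [← Multiset.coe_eq_coe, Multiset.coe_toList]
  refine PTree.Iso.trans (.perm d (hp.map RTree.out)) ?_
  have h2 : List.Forall₂ PTree.Iso ((l.map RTree.mk).map RTree.out) l := by
    clear hp
    induction l with
    | nil => exact .nil
    | cons a l ih => exact .cons (RTree.out_mk a) ih
  simpa using PTree.Iso.of_forall₂ d h2 []

/-! ### Admissible cuts -/

mutual
/-- The pairs `(P^c(t), R^c(t))`, listed with multiplicity, where `c` runs over the non-total
admissible cuts of `t` (the empty cut is included, and gives `(1, t)`). -/
def PTree.cuts {D : Type*} : PTree D → Multiset (Multiset (RTree D) × RTree D)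
  | .node d l => (PTree.cutsList l).map fun p => (p.1, RTree.graft d p.2)
/-- Admissible cuts of a tree with a root to which the trees of the list are attached: for each
tree `t` of the list, either the edge joining `t` to the root is cut (and then no edge of `t`
is), or it is not and one chooses a non-total admissible cut of `t`. A pair consists of the
pruned trees and of the subtrees which remain attached to the root. -/
def PTree.cutsList {D : Type*} :
    List (PTree D) → Multiset (Multiset (RTree D) × Multiset (RTree D))
  | [] => {(0, 0)}
  | t :: l =>
    ((({RTree.mk t}, 0) ::ₘ (PTree.cuts t).map fun p => (p.1, {p.2})) ×ˢ PTree.cutsList l).map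
      fun q => q.1 + q.2
end

theorem PTree.cutsList_perm {D : Type*} {l l' : List (PTree D)} (h : l.Perm l') :
    PTree.cutsList l = PTree.cutsList l' := by
  induction h with
  | nil => rfl
  | cons t _ ih => simp only [PTree.cutsList, ih]
  | swap t t' l =>
    simp only [PTree.cutsList]
    generalize ((({RTree.mk t}, 0) ::ₘ (PTree.cuts t).map fun p => (p.1, {p.2})) :
      Multiset (Multiset (RTree D) × Multiset (RTree D))) = A
    generalize ((({RTree.mk t'}, 0) ::ₘ (PTree.cuts t').map fun p => (p.1, {p.2})) :
      Multiset (Multiset (RTree D) × Multiset (RTree D))) = B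
    generalize PTree.cutsList l = C
    simp only [SProd.sprod, Multiset.product, Multiset.map_bind, Multiset.map_map, Function.comp_def]
    rw [Multiset.bind_bind]
    refine Multiset.bind_congr fun a _ => Multiset.bind_congr fun b _ => ?_
    exact Multiset.map_congr rfl fun c _ => add_left_comm _ _ _
  | trans _ _ ih ih' => exact ih.trans ih'

theorem PTree.cuts_congr {D : Type*} {t t' : PTree D} (h : PTree.Iso t t') :
    t.cuts = t'.cuts := by
  induction h with
  | perm d h => simp only [PTree.cuts, PTree.cutsList_perm h]
  | @child d t t' l ht ih =>
    have : RTree.mk t = RTree.mk t' := Quotient.sound ht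
    simp only [PTree.cuts, PTree.cutsList, ih, this]
  | symm _ ih => exact ih.symm
  | trans _ _ ih ih' => exact ih.trans ih'

/-- The pairs `(P^c(t), R^c(t))`, `c` running over the non-total admissible cuts of `t`. -/
def RTree.cuts {D : Type*} : RTree D → Multiset (Multiset (RTree D) × RTree D) :=
  Quotient.lift PTree.cuts fun _ _ h => PTree.cuts_congr h

theorem RTree.weight_graft {D : Type*} (d : D) (s : Multiset (RTree D)) :
    (RTree.graft d s).weight = 1 + (s.map RTree.weight).sum := by
  have hs : ∃ l : List (PTree D), (↑(l.map RTree.mk) : Multiset (RTree D)) = s := by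
    refine ⟨s.toList.map RTree.out, ?_⟩
    have : (RTree.mk ∘ RTree.out : RTree D → RTree D) = id := funext RTree.mk_out
    rw [List.map_map, this, List.map_id, Multiset.coe_toList]
  obtain ⟨l, rfl⟩ := hs
  rw [RTree.graft_coe, Multiset.map_coe, Multiset.sum_coe, List.map_map]
  exact PTree.weight_node d l

mutual
theorem PTree.weight_cuts {D : Type*} : ∀ (t : PTree D), ∀ p ∈ t.cuts,
    (p.1.map RTree.weight).sum + p.2.weight = t.weight
  | .node d l, p, hp => by
    rw [PTree.cuts, Multiset.mem_map] at hp
    obtain ⟨q, hq, rfl⟩ := hp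
    have := PTree.weight_cutsList l q hq
    simp only [RTree.weight_graft, PTree.weight_node]
    omega
theorem PTree.weight_cutsList {D : Type*} : ∀ (l : List (PTree D)), ∀ p ∈ PTree.cutsList l,
    (p.1.map RTree.weight).sum + (p.2.map RTree.weight).sum = (l.map PTree.weight).sum
  | [], p, hp => by
    rw [PTree.cutsList, Multiset.mem_singleton] at hp
    subst hp
    simp
  | t :: l, p, hp => by
    rw [PTree.cutsList, Multiset.mem_map] at hp
    obtain ⟨⟨q, q'⟩, hq, rfl⟩ := hp
    rw [Multiset.mem_product] at hq
    obtain ⟨hq, hq'⟩ := hq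
    have h1 := PTree.weight_cutsList l q' hq'
    have h2 : (q.1.map RTree.weight).sum + (q.2.map RTree.weight).sum = t.weight := by
      rw [Multiset.mem_cons, Multiset.mem_map] at hq
      rcases hq with rfl | ⟨s, hs, rfl⟩
      · simp; rfl
      · have := PTree.weight_cuts t s hs
        simpa using this
    simp only [Prod.fst_add, Prod.snd_add, Multiset.map_add, Multiset.sum_add, List.map_cons,
      List.sum_cons]
    omega
end

theorem RTree.weight_cuts {D : Type*} (t : RTree D) (p : Multiset (RTree D) × RTree D)
    (hp : p ∈ t.cuts) : (p.1.map RTree.weight).sum + p.2.weight = t.weight := by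
  induction t using Quotient.inductionOn with
  | h t => exact PTree.weight_cuts t p hp

/-! ### The Hopf algebra of decorated rooted trees -/

/-- `H_D`: the polynomial algebra generated by the decorated rooted trees. Its monomials are the
forests. -/
abbrev TreeAlg (K D : Type*) [Field K] : Type _ := MvPolynomial (RTree D) K

namespace TreeAlg

variable (K : Type*) {D : Type*} [Field K]

/-- The forest with the given trees, as an element of `H_D`. -/
def forest (s : Multiset (RTree D)) : TreeAlg K D :=
  (s.map MvPolynomial.X).prod

/-- `B⁺_d : H_D → H_D`, the linear map which sends a forest to the tree obtained by grafting its
trees on a common root decorated by `d`. -/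
def Bplus (d : D) : TreeAlg K D →ₗ[K] TreeAlg K D :=
  (MvPolynomial.basisMonomials (RTree D) K).constr K
    fun m => MvPolynomial.X (RTree.graft d (Finsupp.toMultiset m))

/-- The coproduct of `H_D`: the algebra morphism with
`Δ(t) = t ⊗ 1 + ∑ P^c(t) ⊗ R^c(t)`, the sum being over the non-total admissible cuts. -/
def comul : TreeAlg K D →ₐ[K] TreeAlg K D ⊗[K] TreeAlg K D :=
  MvPolynomial.aeval fun t =>
    MvPolynomial.X t ⊗ₜ[K] 1 +
      (t.cuts.map fun p => forest K p.1 ⊗ₜ[K] (MvPolynomial.X p.2 : TreeAlg K D)).sum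

/-- The counit of `H_D`, which vanishes on the nonempty forests. -/
def counit : TreeAlg K D →ₐ[K] K := MvPolynomial.aeval fun _ => 0

/-- `H_D(n)`: the span of the forests with `n` vertices. -/
def homog (D : Type*) (n : ℕ) : Submodule K (TreeAlg K D) :=
  MvPolynomial.weightedHomogeneousSubmodule K RTree.weight n

/-- The projection `π` of `H_D` on the span of the trees, which vanishes on the forests which
are not trees. -/
def proj : TreeAlg K D →ₗ[K] TreeAlg K D := MvPolynomial.homogeneousComponent 1

/-- A subalgebra `A` of `H_D` which satisfies `Δ(A) ⊆ A ⊗ A`. The subalgebras considered here are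
generated by elements that are homogeneous for the number of vertices, so they are graded and
connected, and this is the condition to be a Hopf subalgebra (the antipode then automatically
preserves `A`). -/
def IsHopfSubalgebra {K D : Type*} [Field K] (A : Subalgebra K (TreeAlg K D)) : Prop :=
  A.map (comul K) ≤ (Algebra.TensorProduct.map A.val A.val).range

theorem proj_mul (a b : TreeAlg K D) :
    proj K (a * b) = counit K a • proj K b + counit K b • proj K a := by
  classical
  have hc : ∀ x : TreeAlg K D, counit K x = MvPolynomial.coeff 0 x := by
    intro x
    simp [counit, MvPolynomial.constantCoeff_eq]
  ext d
  simp only [proj, MvPolynomial.coeff_add, MvPolynomial.coeff_smul,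
    MvPolynomial.coeff_homogeneousComponent, smul_eq_mul]
  by_cases hd : d.degree = 1
  · have hd0 : d ≠ 0 := by rintro rfl; simp at hd
    rw [if_pos hd, if_pos hd, if_pos hd, hc, hc, MvPolynomial.coeff_mul,
      Finset.sum_eq_add (0, d) (d, 0)]
    · ring
    · intro h
      exact hd0 (Prod.ext_iff.1 h).2
    · rintro ⟨p, q⟩ hpq ⟨h1, h2⟩
      exfalso
      rw [Finset.HasAntidiagonal.mem_antidiagonal] at hpq
      simp only at hpq
      subst hpq
      rw [map_add] at hd
      have : p.degree = 0 ∨ q.degree = 0 := by omega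
      rcases this with h | h <;> rw [Finsupp.degree_eq_zero_iff] at h <;> subst h <;> simp_all
    · intro h; exact absurd (by simp) h
    · intro h; exact absurd (by simp) h
  · simp [hd]

end TreeAlg

/-! ### Systems of Dyson-Schwinger equations -/

namespace SDSE

variable {K I : Type*} [Field K]

/-- The map `∑ yₙ ↦ ∑ B⁺_d(yₙ)`. An element `∑ yₙ`, `yₙ ∈ H_D(n)`, of the completion
`∏ H_D(n)` of `H_D` is written as the power series `∑ yₙ Tⁿ` over `H_D`. As `B⁺_d(yₙ)` has
degree `n + 1`, it is the coefficient of `Tⁿ⁺¹` of the image. -/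
def completedBplus (d : I) (y : PowerSeries (TreeAlg K I)) : PowerSeries (TreeAlg K I) :=
  PowerSeries.mk fun n =>
    match n with
    | 0 => 0
    | n + 1 => TreeAlg.Bplus K d (PowerSeries.coeff n y)

/-- The formal series `F_i` of a system are not constant. -/
def NonConstant (F : I → MvPowerSeries I K) : Prop := ∀ i, ∀ c : K, F i ≠ MvPowerSeries.C c

/-- `(X_i)` is a family of elements of the completion of `H_I` which is a solution of the system
`X_i = B⁺_i(F_i(X_j, j ∈ I))`. The coefficient of `Tⁿ` of `X i` is the homogeneous component
`X_i(n)`. -/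
structure IsSolution (F : I → MvPowerSeries I K) (X : I → PowerSeries (TreeAlg K I)) : Prop where
  mem_homog : ∀ i n, PowerSeries.coeff n (X i) ∈ TreeAlg.homog K I n
  eqn : ∀ i, X i = completedBplus i (MvPowerSeries.subst X (F i))

/-- `H_(S)`: the subalgebra of `H_I` generated by the homogeneous components of the `X_i`. -/
def generated (X : I → PowerSeries (TreeAlg K I)) : Subalgebra K (TreeAlg K I) :=
  Algebra.adjoin K {x | ∃ i n, x = PowerSeries.coeff n (X i)}

/-- The formal series `F_i` are not constant, so that they define an SDSE, and this SDSE is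
Hopf. -/
def IsHopf (F : I → MvPowerSeries I K) : Prop :=
  NonConstant F ∧ ∃ X : I → PowerSeries (TreeAlg K I), IsSolution F X ∧
    TreeAlg.IsHopfSubalgebra (generated X)

open Classical in
/-- The formal series `F_i = 1 + ∑_{i → j} h_j` attached to an oriented graph. -/
def graphSeries (K : Type*) {I : Type*} [Field K] [Fintype I] (G : Digraph I) (i : I) :
    MvPowerSeries I K :=
  1 + ∑ j with G.Adj i j, MvPowerSeries.X j

end SDSE

/-! ### The pre-Lie algebra of a Hopf subalgebra -/

namespace TreeAlg

variable {K D : Type*} [Field K]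

/-- The primitive elements of the graded dual of `A`: the linear forms on `A` which vanish on
the elements of degree `≥ N` for some `N`, and which are primitive for the coproduct dual to the
product of `A`. -/
def primDual (A : Subalgebra K (TreeAlg K D)) : Submodule K (Module.Dual K A) where
  carrier := {f | (∃ N : ℕ, ∀ n ≥ N, ∀ a : A, (a : TreeAlg K D) ∈ homog K D n → f a = 0) ∧
    ∀ a b : A, f (a * b) = f a * counit K (b : TreeAlg K D) + counit K (a : TreeAlg K D) * f b}
  add_mem' := by
    rintro f g ⟨⟨N, hN⟩, hf⟩ ⟨⟨M, hM⟩, hg⟩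
    refine ⟨⟨max N M, fun n hn a ha => ?_⟩, fun a b => ?_⟩
    · rw [LinearMap.add_apply, hN n (le_trans (le_max_left _ _) hn) a ha,
        hM n (le_trans (le_max_right _ _) hn) a ha, add_zero]
    · simp only [LinearMap.add_apply, hf, hg]; ring
  zero_mem' := ⟨⟨0, fun _ _ _ _ => rfl⟩, fun a b => by simp⟩
  smul_mem' := by
    rintro c f ⟨⟨N, hN⟩, hf⟩
    refine ⟨⟨N, fun n hn a ha => ?_⟩, fun a b => ?_⟩
    · rw [LinearMap.smul_apply, hN n hn a ha, smul_zero]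
    · simp only [LinearMap.smul_apply, hf, smul_eq_mul]; ring

theorem tensor_val_injective (A : Subalgebra K (TreeAlg K D)) :
    Function.Injective (Algebra.TensorProduct.map A.val A.val) := by
  exact TensorProduct.map_injective_of_flat_flat A.val.toLinearMap A.val.toLinearMap
    Subtype.val_injective Subtype.val_injective

/-- The coproduct of a Hopf subalgebra. -/
def comulRestrict (A : Subalgebra K (TreeAlg K D)) (hA : IsHopfSubalgebra A) :
    A →ₗ[K] A ⊗[K] A :=
  (LinearEquiv.ofInjective (Algebra.TensorProduct.map A.val A.val).toLinearMap
      (tensor_val_injective A)).symm.toLinearMap ∘ₗ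
    LinearMap.codRestrict _ ((comul K).toLinearMap ∘ₗ A.val.toLinearMap)
      fun a => hA ⟨a, a.2, rfl⟩

theorem comulRestrict_spec (A : Subalgebra K (TreeAlg K D)) (hA : IsHopfSubalgebra A) (a : A) :
    Algebra.TensorProduct.map A.val A.val (comulRestrict A hA a) = comul K (a : TreeAlg K D) := by
  have := LinearEquiv.ofInjective_apply (Algebra.TensorProduct.map A.val A.val).toLinearMap
    (h := tensor_val_injective A) (comulRestrict A hA a)
  simp only [comulRestrict, LinearMap.comp_apply, LinearEquiv.coe_coe,
    LinearEquiv.apply_symm_apply] at this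
  exact this.symm

end TreeAlg

namespace SDSE

open TreeAlg

variable {K I : Type*} [Field K]

theorem proj_Bplus (d : I) (y : TreeAlg K I) : proj K (Bplus K d y) = Bplus K d y := by
  have : proj K ∘ₗ Bplus K d = Bplus K d := by
    refine (MvPolynomial.basisMonomials (RTree I) K).ext fun m => ?_
    simp only [LinearMap.comp_apply, Bplus, Module.Basis.constr_basis, proj]
    exact MvPolynomial.homogeneousComponent_eq_self (MvPolynomial.isHomogeneous_X _ _)
  exact LinearMap.congr_fun this y

theorem IsSolution.proj_coeff {F : I → MvPowerSeries I K} {X : I → PowerSeries (TreeAlg K I)}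
    (hX : IsSolution F X) (i : I) (n : ℕ) :
    proj K (PowerSeries.coeff n (X i)) = PowerSeries.coeff n (X i) := by
  rw [hX.eqn i, completedBplus, PowerSeries.coeff_mk]
  cases n with
  | zero => simp
  | succ n => exact proj_Bplus i _

theorem IsSolution.proj_mem {F : I → MvPowerSeries I K} {X : I → PowerSeries (TreeAlg K I)}
    (hX : IsSolution F X) {a : TreeAlg K I} (ha : a ∈ generated X) :
    proj K a ∈ generated X := by
  induction ha using Algebra.adjoin_induction with
  | mem x hx =>
    obtain ⟨i, n, rfl⟩ := hx
    rw [hX.proj_coeff]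
    exact Algebra.subset_adjoin ⟨i, n, rfl⟩
  | algebraMap c =>
    have : proj K (algebraMap K (TreeAlg K I) c) = 0 := by
      have := MvPolynomial.homogeneousComponent_of_mem (m := 1)
        ((MvPolynomial.mem_homogeneousSubmodule _ _).2 (MvPolynomial.isHomogeneous_C (RTree I) c))
      simpa [proj] using this
    rw [this]
    exact Subalgebra.zero_mem _
  | add x y _ _ hx hy => rw [map_add]; exact Subalgebra.add_mem _ hx hy
  | mul x y hx' hy' hx hy =>
    rw [proj_mul]
    exact Subalgebra.add_mem _ (Subalgebra.smul_mem _ hy _) (Subalgebra.smul_mem _ hx _)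

/-- The projection `π`, restricted to `H_(S)`: its image is the span of the `X_i(n)`. -/
def projRestrict {F : I → MvPowerSeries I K} {X : I → PowerSeries (TreeAlg K I)}
    (hX : IsSolution F X) : generated X →ₗ[K] generated X :=
  (proj K).restrict (p := Subalgebra.toSubmodule (generated X))
    (q := Subalgebra.toSubmodule (generated X)) fun _ ha => hX.proj_mem ha

/-- Elements of `H_(S)` have their homogeneous components in `H_(S)`. -/
theorem IsSolution.component_mem {F : I → MvPowerSeries I K} {X : I → PowerSeries (TreeAlg K I)}
    (hX : IsSolution F X) {a : TreeAlg K I} (ha : a ∈ generated X) (n : ℕ) :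
    MvPolynomial.weightedHomogeneousComponent RTree.weight n a ∈ generated X := by
  have hs : ∀ x ∈ Submonoid.closure {x | ∃ i n, x = PowerSeries.coeff n (X i)},
      x ∈ generated X ∧ ∃ m, x ∈ homog K I m := by
    intro x hx
    induction hx using Submonoid.closure_induction with
    | mem x hx =>
      obtain ⟨i, n, rfl⟩ := hx
      exact ⟨Algebra.subset_adjoin ⟨i, n, rfl⟩, n, hX.mem_homog i n⟩
    | one => exact ⟨Subalgebra.one_mem _, 0, MvPolynomial.isWeightedHomogeneous_one _ _⟩
    | mul x y _ _ hx hy =>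
      obtain ⟨hx, m, hm⟩ := hx
      obtain ⟨hy, k, hk⟩ := hy
      exact ⟨Subalgebra.mul_mem _ hx hy, m + k, MvPolynomial.IsWeightedHomogeneous.mul hm hk⟩
  rw [generated, ← Subalgebra.mem_toSubmodule, Algebra.adjoin_eq_span] at ha
  induction ha using Submodule.span_induction with
  | mem x hx =>
    classical
    obtain ⟨hx, m, hm⟩ := hs x hx
    rw [MvPolynomial.weightedHomogeneousComponent_of_mem hm]
    split_ifs
    · exact hx
    · exact Subalgebra.zero_mem _
  | zero => rw [map_zero]; exact Subalgebra.zero_mem _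
  | add x y _ _ hx hy => rw [map_add]; exact Subalgebra.add_mem _ hx hy
  | smul c x _ hx => rw [map_smul]; exact Subalgebra.smul_mem _ hx _

/-- A form of the graded dual of `H_(S)` extends to a form of the graded dual of `H_I`. -/
theorem IsSolution.exists_extension {F : I → MvPowerSeries I K}
    {X : I → PowerSeries (TreeAlg K I)} (hX : IsSolution F X) {f : Module.Dual K (generated X)}
    {N : ℕ} (hf : ∀ n ≥ N, ∀ a : generated X, (a : TreeAlg K I) ∈ homog K I n → f a = 0) :
    ∃ g : Module.Dual K (TreeAlg K I), (∀ a : generated X, g a = f a) ∧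
      ∀ n ≥ N, ∀ a ∈ homog K I n, g a = 0 := by
  classical
  obtain ⟨g, hg⟩ := LinearMap.exists_extend (p := Subalgebra.toSubmodule (generated X)) f
  have hg' : ∀ a : generated X, g a = f a := fun a => LinearMap.congr_fun hg a
  let c := fun n => MvPolynomial.weightedHomogeneousComponent (R := K)
    (RTree.weight (D := I)) n
  refine ⟨∑ n ∈ Finset.range N, g ∘ₗ c n, fun a => ?_, fun n hn a ha => ?_⟩
  · have h1 : ∀ n ≥ N, g (c n a) = 0 := fun n hn => by
      have := hg' ⟨c n a, hX.component_mem a.2 n⟩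
      rw [hf n hn _ (MvPolynomial.weightedHomogeneousComponent_mem _ _ _)] at this
      exact this
    have h2 := MvPolynomial.sum_weightedHomogeneousComponent (R := K)
      (RTree.weight (D := I)) (a : TreeAlg K I)
    have h3 := MvPolynomial.weightedHomogeneousComponent_finsupp (w := RTree.weight (D := I))
      (a : TreeAlg K I)
    rw [finsum_eq_sum_of_support_subset (s := h3.toFinset ∪ Finset.range N) _
      (fun n hn => by
        rw [Finset.coe_union]
        exact Or.inl (Finset.mem_coe.2 (h3.mem_toFinset.2 hn)))] at h2
    rw [LinearMap.sum_apply, ← hg' a]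
    nth_rewrite 2 [← h2]
    rw [map_sum]
    refine Finset.sum_subset Finset.subset_union_right fun n _ hn => ?_
    exact h1 n (by simpa using hn)
  · rw [LinearMap.sum_apply]
    refine Finset.sum_eq_zero fun m hm => ?_
    rw [Finset.mem_range] at hm
    simp only [LinearMap.comp_apply, c]
    rw [MvPolynomial.weightedHomogeneousComponent_of_mem ha, if_neg (by omega), map_zero]

end SDSE

namespace TreeAlg

variable (K : Type*) {D : Type*} [Field K]

/-- `∑_{p + q = n} H_D(p) ⊗ H_D(q)`. -/
def homogTensor (D : Type*) (n : ℕ) : Submodule K (TreeAlg K D ⊗[K] TreeAlg K D) :=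
  Submodule.span K {x | ∃ p q, p + q = n ∧ ∃ a ∈ homog K D p, ∃ b ∈ homog K D q, x = a ⊗ₜ b}

variable {K}

theorem homogTensor_mul {m n : ℕ} {x y : TreeAlg K D ⊗[K] TreeAlg K D}
    (hx : x ∈ homogTensor K D m) (hy : y ∈ homogTensor K D n) :
    x * y ∈ homogTensor K D (m + n) := by
  have h := Submodule.mul_mem_mul hx hy
  rw [homogTensor, homogTensor, Submodule.span_mul_span] at h
  refine Submodule.span_mono ?_ h
  rintro _ ⟨_, ⟨p, q, hpq, a, ha, b, hb, rfl⟩, _, ⟨p', q', hpq', a', ha', b', hb', rfl⟩, rfl⟩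
  refine ⟨p + p', q + q', by omega, a * a', MvPolynomial.IsWeightedHomogeneous.mul ha ha',
    b * b', MvPolynomial.IsWeightedHomogeneous.mul hb hb', ?_⟩
  simp

theorem homogTensor_one : (1 : TreeAlg K D ⊗[K] TreeAlg K D) ∈ homogTensor K D 0 :=
  Submodule.subset_span ⟨0, 0, rfl, 1, MvPolynomial.isWeightedHomogeneous_one _ _, 1,
    MvPolynomial.isWeightedHomogeneous_one _ _, rfl⟩

theorem forest_mem (s : Multiset (RTree D)) :
    forest K s ∈ homog K D (s.map RTree.weight).sum := by
  induction s using Multiset.induction_on with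
  | empty => exact MvPolynomial.isWeightedHomogeneous_one _ _
  | cons t s ih =>
    have : forest K (t ::ₘ s) = MvPolynomial.X t * forest K s := by simp [forest]
    rw [this, Multiset.map_cons, Multiset.sum_cons]
    exact MvPolynomial.IsWeightedHomogeneous.mul (MvPolynomial.isWeightedHomogeneous_X _ _ _) ih

theorem comul_X_mem (t : RTree D) :
    comul K (MvPolynomial.X t) ∈ homogTensor K D t.weight := by
  rw [comul, MvPolynomial.aeval_X]
  refine Submodule.add_mem _ (Submodule.subset_span ⟨t.weight, 0, rfl, _,
    MvPolynomial.isWeightedHomogeneous_X _ _ _, 1,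
    MvPolynomial.isWeightedHomogeneous_one _ _, rfl⟩) ?_
  refine multiset_sum_mem _ fun x hx => ?_
  obtain ⟨p, hp, rfl⟩ := Multiset.mem_map.1 hx
  exact Submodule.subset_span ⟨_, _, RTree.weight_cuts t p hp, _, forest_mem _, _,
    MvPolynomial.isWeightedHomogeneous_X _ _ _, rfl⟩

theorem comul_mem {n : ℕ} {x : TreeAlg K D} (hx : x ∈ homog K D n) :
    comul K x ∈ homogTensor K D n := by
  have key : ∀ d : RTree D →₀ ℕ, comul K (MvPolynomial.monomial d (1 : K)) ∈
      homogTensor K D (Finsupp.weight RTree.weight d) := by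
    intro d
    induction d using Finsupp.induction_linear with
    | zero => simpa using homogTensor_one
    | add d e hd he =>
      have : MvPolynomial.monomial (d + e) (1 : K) =
          MvPolynomial.monomial d 1 * MvPolynomial.monomial e 1 := by
        rw [MvPolynomial.monomial_mul, one_mul]
      rw [this, map_mul, map_add]
      exact homogTensor_mul hd he
    | single t k =>
      rw [← MvPolynomial.X_pow_eq_monomial, map_pow, Finsupp.weight_single, smul_eq_mul]
      induction k with
      | zero => simpa using homogTensor_one
      | succ k ih =>
        rw [pow_succ, add_mul, one_mul]
        exact homogTensor_mul ih (comul_X_mem t)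
  rw [x.as_sum, map_sum]
  refine Submodule.sum_mem _ fun d hd => ?_
  have hd' : Finsupp.weight RTree.weight d = n := hx (MvPolynomial.mem_support_iff.1 hd)
  have : MvPolynomial.monomial d (MvPolynomial.coeff d x) =
      MvPolynomial.coeff d x • MvPolynomial.monomial d (1 : K) := by
    rw [MvPolynomial.smul_monomial, smul_eq_mul, mul_one]
  rw [this, map_smul, ← hd']
  exact Submodule.smul_mem _ _ (key d)

theorem proj_mem_homog {n : ℕ} {x : TreeAlg K D} (hx : x ∈ homog K D n) :
    proj K x ∈ homog K D n := by
  classical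
  intro d hd
  rw [proj, MvPolynomial.coeff_homogeneousComponent] at hd
  split_ifs at hd with h
  · exact hx hd
  · exact absurd rfl hd

end TreeAlg

namespace SDSE

open TreeAlg

variable {K I : Type*} [Field K] {F : I → MvPowerSeries I K} {X : I → PowerSeries (TreeAlg K I)}

/-- The linear form on `H_(S)` which vanishes on `1` and on the products of two elements of the
augmentation ideal (that is, `π` is applied first) and whose value at `x` in the span of the
`X_i(n)` is `(f ⊗ g) ∘ (π ⊗ π) ∘ Δ (x)`. -/
def preLieForm (hX : IsSolution F X) (hA : IsHopfSubalgebra (generated X))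
    (f g : Module.Dual K (generated X)) : Module.Dual K (generated X) :=
  LinearMap.mul' K K ∘ₗ TensorProduct.map (f ∘ₗ projRestrict hX) (g ∘ₗ projRestrict hX) ∘ₗ
    comulRestrict (generated X) hA ∘ₗ projRestrict hX

theorem preLieForm_mem (hX : IsSolution F X) (hA : IsHopfSubalgebra (generated X))
    {f g : Module.Dual K (generated X)} (hf : f ∈ primDual (generated X))
    (hg : g ∈ primDual (generated X)) : preLieForm hX hA f g ∈ primDual (generated X) := by
  refine ⟨?_, fun a b => ?_⟩
  · obtain ⟨⟨N, hN⟩, -⟩ := hf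
    obtain ⟨⟨M, hM⟩, -⟩ := hg
    obtain ⟨f', hf', hN'⟩ := hX.exists_extension hN
    obtain ⟨g', hg', hM'⟩ := hX.exists_extension hM
    refine ⟨N + M, fun n hn a ha => ?_⟩
    have h1 : ∀ y : generated X ⊗[K] generated X,
        LinearMap.mul' K K (TensorProduct.map (f ∘ₗ projRestrict hX) (g ∘ₗ projRestrict hX) y) =
        LinearMap.mul' K K (TensorProduct.map (f' ∘ₗ proj K) (g' ∘ₗ proj K)
          (Algebra.TensorProduct.map (generated X).val (generated X).val y)) := by
      intro y
      induction y using TensorProduct.induction_on with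
      | zero => simp
      | add x y hx hy => simp only [map_add, hx, hy]
      | tmul x y =>
        simp only [TensorProduct.map_tmul, LinearMap.comp_apply, LinearMap.mul'_apply,
          Algebra.TensorProduct.map_tmul, ← hf', ← hg']
        rfl
    have h2 : ∀ y ∈ homogTensor K I n,
        LinearMap.mul' K K (TensorProduct.map (f' ∘ₗ proj K) (g' ∘ₗ proj K) y) = 0 := by
      intro y hy
      induction hy using Submodule.span_induction with
      | zero => simp
      | add x y _ _ hx hy => simp only [map_add, hx, hy, add_zero]
      | smul c x _ hx => simp only [map_smul, hx, smul_zero]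
      | mem x hx =>
        obtain ⟨p, q, hpq, a, ha, b, hb, rfl⟩ := hx
        simp only [TensorProduct.map_tmul, LinearMap.comp_apply, LinearMap.mul'_apply]
        rcases le_or_gt N p with h | h
        · rw [hN' p h _ (proj_mem_homog ha), zero_mul]
        · rw [hM' q (by omega) _ (proj_mem_homog hb), mul_zero]
    simp only [preLieForm, LinearMap.comp_apply]
    rw [h1, comulRestrict_spec]
    exact h2 _ (comul_mem (proj_mem_homog ha))
  · have h : projRestrict hX (a * b) = counit K (a : TreeAlg K I) • projRestrict hX b +
        counit K (b : TreeAlg K I) • projRestrict hX a := Subtype.ext (proj_mul _ _ _)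
    have h' : ∀ c, projRestrict hX (projRestrict hX c) = projRestrict hX c := by
      intro c
      apply Subtype.ext
      exact MvPolynomial.homogeneousComponent_eq_self
        (MvPolynomial.homogeneousComponent_isHomogeneous 1 _)
    simp only [preLieForm, LinearMap.comp_apply, h, map_add, map_smul, smul_eq_mul]
    ring

/-- The pre-Lie algebra `g_(S) = Prim(H_(S)^*)`. -/
abbrev preLieAlgebra (X : I → PowerSeries (TreeAlg K I)) :
    Submodule K (Module.Dual K (generated X)) :=
  primDual (generated X)

/-- The pre-Lie product of `g_(S)`. -/
def preLieProd (hX : IsSolution F X) (hA : IsHopfSubalgebra (generated X))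
    (f g : preLieAlgebra X) : preLieAlgebra X :=
  ⟨preLieForm hX hA f g, preLieForm_mem hX hA f.2 g.2⟩

/-- `f ⋆ g` is the only element of `g_(S)` with
`(f ⋆ g)(x) = (f ⊗ g) ∘ (π ⊗ π) ∘ Δ (x)` for all `x` in the span of the `X_i(n)`. -/
theorem eq_preLieProd_iff (hX : IsSolution F X) (hA : IsHopfSubalgebra (generated X))
    (f g h : preLieAlgebra X) :
    h = preLieProd hX hA f g ↔ ∀ i n (x : generated X), (x : TreeAlg K I) = PowerSeries.coeff n (X i) →
      h.1 x = LinearMap.mul' K K (TensorProduct.map (f.1 ∘ₗ projRestrict hX)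
        (g.1 ∘ₗ projRestrict hX) (comulRestrict (generated X) hA x)) := by
  have h' : ∀ i n (x : generated X), (x : TreeAlg K I) = PowerSeries.coeff n (X i) →
      projRestrict hX x = x := fun i n x hx => by
    apply Subtype.ext
    change proj K (x : TreeAlg K I) = x
    rw [hx, hX.proj_coeff]
  constructor
  · rintro rfl i n x hx
    simp only [preLieProd, preLieForm, LinearMap.comp_apply, h' i n x hx]
  · intro H
    have one : ∀ k : preLieAlgebra X, k.1 1 = 0 := fun k => by
      have := k.2.2 1 1
      simpa using this
    apply Subtype.ext
    apply LinearMap.ext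
    rintro ⟨x, hx⟩
    induction hx using Algebra.adjoin_induction with
    | mem x hx =>
      obtain ⟨i, n, rfl⟩ := hx
      rw [H i n _ rfl]
      simp only [preLieProd, preLieForm, LinearMap.comp_apply]
      rw [h' i n _ rfl]
    | algebraMap c =>
      have e : (⟨algebraMap K _ c, Subalgebra.algebraMap_mem _ c⟩ : generated X) = c • 1 :=
        Subtype.ext (Algebra.algebraMap_eq_smul_one c)
      exact (congrArg h.1 e).trans (Eq.trans (by rw [map_smul, map_smul, one, one])
        (congrArg (preLieProd hX hA f g).1 e).symm)
    | add x y hx hy ihx ihy =>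
      have e : (⟨x + y, Subalgebra.add_mem _ hx hy⟩ : generated X) = ⟨x, hx⟩ + ⟨y, hy⟩ := rfl
      exact (congrArg h.1 e).trans (Eq.trans (by rw [map_add, map_add, ihx, ihy])
        (congrArg (preLieProd hX hA f g).1 e).symm)
    | mul x y hx hy ihx ihy =>
      have e : (⟨x * y, Subalgebra.mul_mem _ hx hy⟩ : generated X) = ⟨x, hx⟩ * ⟨y, hy⟩ := rfl
      exact (congrArg h.1 e).trans (Eq.trans (by
        rw [h.2.2, (preLieProd hX hA f g).2.2, ihx, ihy]) (congrArg (preLieProd hX hA f g).1 e).symm)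

end SDSE

end

/-!
Call a graph coherent if it satisfies condition (c). Then the end points of the paths with `m + 1`
edges from `i` are the direct descendants of the end of any single path with `m` edges from `i`
(`Digraph.Coherent.hasPath_succ_iff`), and everything rests on this.

In `A_G`, the product of two paths is their concatenation, or zero if they cannot be concatenated.
By coherence, which of the two occurs for `P_j(n) P_i(m)` depends only on whether there is a path
with `m` edges from `i` to `j`; this is the multiplication table `GraphAlg.P_mul_P`, and it shows
that the `P_i(n)` span `A_G`. Coherence is also what makes the operators given by this table on the
space with basis `1`, `P_i(n)` satisfy the relations of `A_G`; the resulting representation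
(`GraphAlg.leftRep`) sends `P_i(n)` to an operator that maps `1` to `P_i(n)`, whence the linear
independence. Conversely, if `P_i(3)` does not vanish and `i → j → l`, `i → k`, then
`P_l(1) P_k(1) P_i(1) = P_l(1) P_j(1) P_i(1) ≠ 0` forces `k → l`.

The series `F_i` being affine, `X_i(n)` is the sum of the ladders (trees without ramification) read
along the paths with `n` vertices from `i` (`SDSE.IsSolution.treeCoeff_ladder`). Its coproduct cuts
each path at a vertex. If the graph is coherent, the end points of the possible prolongations do
not depend on the path, so the sum factorizes (`SDSE.map_componentComul`) and the system is Hopf.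
If `i → j` and `i → k`, no element of `H_(S)` distinguishes the ladders `(i, j)` and `(i, k)`. So if
the system is Hopf, the prolongations of these ladders, which appear as left factors in
`Δ(X_i(3))`, are the same (`SDSE.adj_iff_of_isHopfSubalgebra`).

An element of `g_(S)` is determined by its values at the `X_i(n)`, and the coefficient of a ladder
in `X_i(n)` is an element dual to `X_i(n)`. These forms make up a basis of `g_(S)` whose
multiplication table, read off the coproduct of the `X_i(n)`, is that of the `P_i(n)`
(`SDSE.preLieProd_dualForm`). Associativity is carried over from `A_G` by the isomorphism.
-/

open scoped TensorProduct

noncomputable section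

/-! ### Presented algebras -/

/-- The morphism from the free non-unitary algebra that sends the generator of index `i` to
`g i`. -/
def FreeNU.lift {K I A : Type*} [Field K] [NonUnitalRing A] [Module K A] [IsScalarTower K A A]
    [SMulCommClass K A A] (g : I → A) : FreeNU K I →ₙₐ[K] A :=
  MonoidAlgebra.liftMagma K (FreeSemigroup.lift g)

theorem FreeNU.lift_gen {K I A : Type*} [Field K] [NonUnitalRing A] [Module K A]
    [IsScalarTower K A A] [SMulCommClass K A A] (g : I → A) (i : I) :
    FreeNU.lift g (FreeNU.gen K i) = g i := by
  simp [FreeNU.lift, FreeNU.gen]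

theorem map_pathProd {I A B F : Type*} [Mul A] [Mul B] [FunLike F A B] [MulHomClass F A B]
    (f : F) (g : I → A) (i : I) (l : List I) :
    f (pathProd g i l) = pathProd (fun j => f (g j)) i l := by
  induction l generalizing i with
  | nil => rfl
  | cons j l ih => simp only [pathProd, map_mul, ih]

namespace PresAlg

variable {K I A : Type*} [Field K] {r : FreeNU K I → FreeNU K I → Prop} [NonUnitalRing A]
  [Module K A] [IsScalarTower K A A] [SMulCommClass K A A]

/-- The universal property of a presentation. -/
def lift (g : I → A) (h : ∀ x y, r x y → FreeNU.lift g x = FreeNU.lift g y) :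
    PresAlg r →ₙₐ[K] A where
  toFun := Quotient.lift (FreeNU.lift g) fun x y (hxy : PresRel r x y) => by
    induction hxy with
    | of hr => exact h _ _ hr
    | refl => rfl
    | symm _ ih => exact ih.symm
    | trans _ _ ih ih' => exact ih.trans ih'
    | add _ _ ih ih' => rw [map_add, map_add, ih, ih']
    | mul _ _ ih ih' => rw [map_mul, map_mul, ih, ih']
    | smul c _ ih => rw [map_smul, map_smul, ih]
  map_smul' c x := by
    obtain ⟨x, rfl⟩ := mk_surjective r x
    exact map_smul (FreeNU.lift g) c x
  map_zero' := map_zero (FreeNU.lift g)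
  map_add' x y := by
    obtain ⟨x, rfl⟩ := mk_surjective r x
    obtain ⟨y, rfl⟩ := mk_surjective r y
    exact map_add (FreeNU.lift g) x y
  map_mul' x y := by
    obtain ⟨x, rfl⟩ := mk_surjective r x
    obtain ⟨y, rfl⟩ := mk_surjective r y
    exact map_mul (FreeNU.lift g) x y

theorem lift_gen (g : I → A) (h : ∀ x y, r x y → FreeNU.lift g x = FreeNU.lift g y) (i : I) :
    lift g h (gen r i) = g i :=
  FreeNU.lift_gen g i

/-- The quotient map as a morphism of algebras. -/
def mkHom (r : FreeNU K I → FreeNU K I → Prop) : FreeNU K I →ₙₐ[K] PresAlg r where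
  toFun := mk r
  map_smul' := mk_smul r
  map_zero' := mk_zero r
  map_add' := mk_add r
  map_mul' := mk_mul r

theorem lift_eq_mk (r : FreeNU K I → FreeNU K I → Prop) (x : FreeNU K I) :
    FreeNU.lift (gen r) x = mk r x := by
  have : FreeNU.lift (gen r) = mkHom r := by
    apply (MonoidAlgebra.liftMagma K).symm.injective
    apply FreeSemigroup.hom_ext
    funext i
    exact FreeNU.lift_gen (K := K) (gen r) i
  exact DFunLike.congr_fun this x

/-- A subspace that contains the generators and is stable under left multiplication by them is
the whole algebra. -/
theorem eq_top_of_gen_mul_mem (r : FreeNU K I → FreeNU K I → Prop)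
    (S : Submodule K (PresAlg r)) (h1 : ∀ i, gen r i ∈ S)
    (h2 : ∀ i, ∀ x ∈ S, gen r i * x ∈ S) : S = ⊤ := by
  rw [eq_top_iff]
  rintro x -
  obtain ⟨x, rfl⟩ := mk_surjective r x
  induction x using MonoidAlgebra.induction_linear with
  | zero => rw [mk_zero]; exact S.zero_mem
  | add x y hx hy => rw [mk_add]; exact S.add_mem hx hy
  | single w c =>
    have hw : mk r (MonoidAlgebra.single w 1) ∈ S := by
      induction w using FreeSemigroup.recOnMul with
      | ih1 i => exact h1 i
      | ih2 i w _ ih =>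
        have : (MonoidAlgebra.single (FreeSemigroup.of i * w) 1 : FreeNU K I) =
            FreeNU.gen K i * MonoidAlgebra.single w 1 := by
          rw [FreeNU.gen, MonoidAlgebra.single_mul_single, one_mul]
        rw [this, mk_mul]
        exact h2 i _ ih
    have : (MonoidAlgebra.single w c : FreeNU K I) = c • MonoidAlgebra.single w 1 := by
      simp
    rw [this, mk_smul]
    exact S.smul_mem c hw

end PresAlg

/-! ### Paths in oriented graphs -/

/-- Every vertex has a direct descendant, and vertices with a common direct ascendant have the
same direct descendants. -/
def Digraph.Coherent {I : Type*} (G : Digraph I) : Prop :=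
  (∀ i, ∃ j, G.Adj i j) ∧ ∀ i j k, G.Adj i j → G.Adj i k → ∀ l, G.Adj j l ↔ G.Adj k l

namespace Digraph.Coherent

variable {I : Type*} {G : Digraph I}

theorem hasPath_congr (hG : G.Coherent) {i j k l : I} (hj : G.Adj i j) (hk : G.Adj i k) (n : ℕ) :
    HasPath G (n + 1) j l ↔ HasPath G (n + 1) k l := by
  simp only [HasPath, hG.2 i j k hj hk]

/-- In a coherent graph, the ends of the paths of length `n + 1` from `i` are the direct
descendants of the end of any single path of length `n` from `i`. -/
theorem hasPath_succ_iff (hG : G.Coherent) {n : ℕ} {i j k : I} (h : HasPath G n i j) :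
    HasPath G (n + 1) i k ↔ G.Adj j k := by
  induction n generalizing i with
  | zero => obtain rfl := h; simp [HasPath]
  | succ n ih =>
    obtain ⟨a, ha, h⟩ := h
    rw [← ih h]
    constructor
    · rintro ⟨b, hb, h'⟩
      exact (hG.hasPath_congr hb ha n).1 h'
    · exact fun h' => ⟨a, ha, h'⟩

theorem exists_isChain (hG : G.Coherent) (i : I) (n : ℕ) :
    ∃ l : List I, l.length = n ∧ List.IsChain G.Adj (i :: l) := by
  induction n generalizing i with
  | zero => exact ⟨[], rfl, .singleton i⟩
  | succ n ih =>
    obtain ⟨j, hj⟩ := hG.1 i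
    obtain ⟨l, hl, h⟩ := ih j
    exact ⟨j :: l, by simp [hl], .cons_cons hj h⟩

end Digraph.Coherent

theorem hasPath_getLast {I : Type*} {G : Digraph I} {i : I} {l : List I}
    (h : List.IsChain G.Adj (i :: l)) :
    HasPath G l.length i ((i :: l).getLast (List.cons_ne_nil i l)) := by
  induction l generalizing i with
  | nil => rfl
  | cons j l ih =>
    rw [List.isChain_cons_cons] at h
    exact ⟨j, h.1, by simpa using ih h.2⟩

theorem pathProd_append {I A : Type*} [Semigroup A] (g : I → A) (i j : I) (l l' : List I) :
    pathProd g i (l ++ j :: l') = pathProd g j l' * pathProd g i l := by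
  induction l generalizing i with
  | nil => rfl
  | cons k l ih => simp only [List.cons_append, pathProd, ih, mul_assoc]

/-- A product along a concatenation of two paths that cannot be concatenated vanishes. -/
theorem pathProd_mul_pathProd_eq_zero {I A : Type*} [SemigroupWithZero A] (g : I → A) {i j : I}
    {l l' : List I} (h : g j * g ((i :: l).getLast (List.cons_ne_nil i l)) = 0) :
    pathProd g j l' * pathProd g i l = 0 := by
  have h' : g j * pathProd g i l = 0 := by
    induction l generalizing i with
    | nil => exact h
    | cons k l ih => rw [pathProd, ← mul_assoc, ih (by simpa using h), zero_mul]
  cases l' with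
  | nil => exact h'
  | cons k l' => rw [pathProd, mul_assoc, h', mul_zero]

/-! ### The algebra of a graph -/

namespace GraphAlg

variable {K I : Type*} [Field K] {G : Digraph I}

theorem gen_mul_gen_eq_zero {i j : I} (h : ¬ G.Adj i j) :
    PresAlg.gen (GraphRel K G) j * PresAlg.gen (GraphRel K G) i = 0 :=
  (PresAlg.mk_eq_mk _).2 (.of (.zero h))

theorem pathProd_congr {i : I} {l l' : List I} (h : l.length = l'.length)
    (hl : List.IsChain G.Adj (i :: l)) (hl' : List.IsChain G.Adj (i :: l')) :
    pathProd (PresAlg.gen (GraphRel K G)) i l = pathProd (PresAlg.gen (GraphRel K G)) i l' := by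
  rw [← PresAlg.mk_pathProd, ← PresAlg.mk_pathProd]
  exact (PresAlg.mk_eq_mk _).2 (.of (.path h hl hl'))

theorem exists_isChain_of_P_ne_zero {i : I} {n : ℕ} (h : P K G i n ≠ 0) :
    ∃ l : List I, l.length + 1 = n ∧ List.IsChain G.Adj (i :: l) := by
  by_contra h'
  exact h (by rw [P, dif_neg h'])

theorem P_one (i : I) : P K G i 1 = PresAlg.gen (GraphRel K G) i :=
  P_eq K G i [] (.singleton i)

/-- If the `P_i(n)` do not vanish, the graph is coherent: for `i → j → l` and `i → k`, the
element `P_i(3)` is `P_l(1) P_j(1) P_i(1) = P_l(1) P_k(1) P_i(1)`, which vanishes unless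
`k → l`. -/
theorem coherent_of_P_ne_zero (h : ∀ (i : I) (n : ℕ), 1 ≤ n → P K G i n ≠ 0) : G.Coherent := by
  refine ⟨fun i => ?_, ?_⟩
  · obtain ⟨l, hl, hc⟩ := exists_isChain_of_P_ne_zero (h i 2 (by norm_num))
    obtain _ | ⟨j, l⟩ := l
    · simp at hl
    · exact ⟨j, (List.isChain_cons_cons.1 hc).1⟩
  · have key : ∀ i j k, G.Adj i j → G.Adj i k → ∀ l, G.Adj j l → G.Adj k l := by
      intro i j k hj hk l hl
      by_contra hkl
      apply h i 3 (by norm_num)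
      have h2 := pathProd_congr (K := K) (l := [j]) (l' := [k]) rfl
        (.cons_cons hj (.singleton j)) (.cons_cons hk (.singleton k))
      have h3 := P_eq K G i [j, l] (.cons_cons hj (.cons_cons hl (.singleton l)))
      simp only [pathProd] at h2 h3
      rw [mul_assoc, h2, ← mul_assoc, gen_mul_gen_eq_zero hkl, zero_mul] at h3
      exact h3
    exact fun i j k hj hk l => ⟨key i j k hj hk l, key i k j hk hj l⟩

theorem P_mul_P (hG : G.Coherent) {i j : I} {m n : ℕ} (hm : 1 ≤ m) (hn : 1 ≤ n) :
    (HasPath G m i j → P K G j n * P K G i m = P K G i (m + n)) ∧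
      (¬ HasPath G m i j → P K G j n * P K G i m = 0) := by
  obtain ⟨m, rfl⟩ := Nat.exists_eq_add_of_le' hm
  obtain ⟨n, rfl⟩ := Nat.exists_eq_add_of_le' hn
  obtain ⟨l, rfl, hl⟩ := hG.exists_isChain i m
  obtain ⟨l', rfl, hl'⟩ := hG.exists_isChain j n
  rw [hG.hasPath_succ_iff (hasPath_getLast hl), P_eq K G i l hl, P_eq K G j l' hl']
  refine ⟨fun h => ?_, fun h => pathProd_mul_pathProd_eq_zero _ (gen_mul_gen_eq_zero h)⟩
  have hc : List.IsChain G.Adj (i :: (l ++ j :: l')) := by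
    rw [← List.cons_append, List.isChain_append]
    refine ⟨hl, hl', fun x hx y hy => ?_⟩
    rw [List.getLast?_eq_getLast_of_ne_nil (List.cons_ne_nil i l)] at hx
    simp only [Option.mem_def, Option.some.injEq, List.head?_cons] at hx hy
    exact hx ▸ hy ▸ h
  rw [← pathProd_append, ← P_eq K G i _ hc]
  congr 1
  simp
  omega

theorem span_P_eq_top (hG : G.Coherent) :
    Submodule.span K (Set.range fun p : I × ℕ+ => P K G p.1 p.2) = ⊤ := by
  refine PresAlg.eq_top_of_gen_mul_mem _ _ (fun i => Submodule.subset_span ⟨(i, 1), P_one i⟩)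
    fun j x hx => ?_
  induction hx using Submodule.span_induction with
  | mem x hx =>
    obtain ⟨⟨i, m⟩, rfl⟩ := hx
    have h := P_mul_P (K := K) hG (i := i) (j := j) (m := m) m.pos le_rfl
    rw [P_one] at h
    by_cases hp : HasPath G m i j
    · exact (h.1 hp).symm ▸ Submodule.subset_span ⟨(i, m + 1), rfl⟩
    · exact (h.2 hp).symm ▸ Submodule.zero_mem _
  | zero => rw [mul_zero]; exact Submodule.zero_mem _
  | add x y _ _ hx hy => rw [mul_add]; exact Submodule.add_mem _ hx hy
  | smul c x _ hx => rw [mul_smul_comm]; exact Submodule.smul_mem _ c hx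

open Classical in
/-- The action of `P_j(1)` in a representation of `A_G` which, for a coherent graph, is the left
regular representation of the algebra obtained from `A_G` by adjoining a unit: `none` stands for
the unit, and `some (i, m)` for `P_i(m)`. -/
def leftOp (K : Type*) {I : Type*} [Field K] (G : Digraph I) (j : I) :
    Module.End K (Option (I × ℕ) →₀ K) :=
  Finsupp.linearCombination K fun
    | none => Finsupp.single (some (j, 1)) 1
    | some (i, m) => if HasPath G m i j then Finsupp.single (some (i, m + 1)) 1 else 0

theorem leftOp_none (j : I) :
    leftOp K G j (Finsupp.single none 1) = Finsupp.single (some (j, 1)) 1 := by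
  simp [leftOp]

open Classical in
theorem leftOp_some (i j : I) (m : ℕ) :
    leftOp K G j (Finsupp.single (some (i, m)) 1) =
      if HasPath G m i j then Finsupp.single (some (i, m + 1)) 1 else 0 := by
  simp [leftOp]

open Classical in
theorem pathProd_leftOp_some (hG : G.Coherent) {i j : I} {m : ℕ} {l : List I}
    (hl : List.IsChain G.Adj (j :: l)) :
    pathProd (leftOp K G) j l (Finsupp.single (some (i, m)) 1) =
      if HasPath G m i j then Finsupp.single (some (i, m + l.length + 1)) 1 else 0 := by
  induction l generalizing j m with
  | nil => exact leftOp_some i j m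
  | cons k l ih =>
    rw [List.isChain_cons_cons] at hl
    rw [pathProd, Module.End.mul_apply, leftOp_some]
    by_cases h : HasPath G m i j
    · rw [if_pos h, if_pos h, ih hl.2, if_pos ((hG.hasPath_succ_iff h).2 hl.1),
        List.length_cons, add_right_comm m 1, add_assoc m]
    · rw [if_neg h, if_neg h, map_zero]

theorem pathProd_leftOp_none (hG : G.Coherent) {j : I} {l : List I}
    (hl : List.IsChain G.Adj (j :: l)) :
    pathProd (leftOp K G) j l (Finsupp.single none 1) =
      Finsupp.single (some (j, l.length + 1)) 1 := by
  cases l with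
  | nil => exact leftOp_none j
  | cons k l =>
    rw [List.isChain_cons_cons] at hl
    rw [pathProd, Module.End.mul_apply, leftOp_none, pathProd_leftOp_some hG hl.2,
      if_pos ⟨k, hl.1, rfl⟩, List.length_cons, add_comm 1]

/-- The representation of `A_G` by the operators `leftOp`. -/
def leftRep (K : Type*) {I : Type*} [Field K] {G : Digraph I} (hG : G.Coherent) :
    GraphAlg K G →ₙₐ[K] Module.End K (Option (I × ℕ) →₀ K) :=
  PresAlg.lift (leftOp K G) fun x y h => by
    induction h with
    | @zero i j h =>
      rw [map_mul, map_zero, FreeNU.lift_gen, FreeNU.lift_gen]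
      refine Finsupp.lhom_ext' fun s => LinearMap.ext_ring ?_
      rcases s with _ | ⟨k, m⟩
      · have : ¬ HasPath G 1 i j := by simpa [HasPath] using h
        simp [leftOp_none, leftOp_some, this]
      · by_cases hk : HasPath G m k i
        · have : ¬ HasPath G (m + 1) k j := by rwa [hG.hasPath_succ_iff hk]
          simp [leftOp_some, hk, this]
        · simp [leftOp_some, hk]
    | @path i l l' hll hl hl' =>
      rw [map_pathProd, map_pathProd]
      simp only [FreeNU.lift_gen]
      refine Finsupp.lhom_ext' fun s => LinearMap.ext_ring ?_
      rcases s with _ | ⟨k, m⟩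
      · simp [pathProd_leftOp_none hG hl, pathProd_leftOp_none hG hl', hll]
      · simp [pathProd_leftOp_some hG hl, pathProd_leftOp_some hG hl', hll]

theorem linearIndependent_P (hG : G.Coherent) :
    LinearIndependent K (fun p : I × ℕ+ => P K G p.1 p.2) := by
  -- Acting on the unit vector sends `P_i(n)` to the basis vector of index `(i, n)`.
  let ev : GraphAlg K G →ₗ[K] (Option (I × ℕ) →₀ K) :=
    { toFun := fun x => leftRep K hG x (Finsupp.single none 1)
      map_add' := fun x y => by rw [map_add, LinearMap.add_apply]
      map_smul' := fun c x => by rw [map_smul, LinearMap.smul_apply, RingHom.id_apply] }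
  refine LinearIndependent.of_comp ev ?_
  have h : (ev ∘ fun p : I × ℕ+ => P K G p.1 p.2) =
      (fun s => Finsupp.single s (1 : K)) ∘ fun p : I × ℕ+ => some (p.1, (p.2 : ℕ)) := by
    funext ⟨i, n⟩
    obtain ⟨l, hl, hc⟩ := hG.exists_isChain i (n - 1)
    have hn : (n : ℕ) = l.length + 1 := by have := n.pos; omega
    have h1 : ev (P K G i n) = leftRep K hG (P K G i n) (Finsupp.single none 1) := rfl
    simp only [Function.comp_apply]
    rw [h1, hn, P_eq K G i l hc, map_pathProd]
    simp only [leftRep, PresAlg.lift_gen]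
    exact pathProd_leftOp_none hG hc
  rw [h]
  refine (Finsupp.basisSingleOne (R := K)).linearIndependent.comp _ ?_
  rintro ⟨i, n⟩ ⟨i', n'⟩ h
  simpa using h

/-- The simplified relations hold in `A_G`. -/
def ofSimple (K : Type*) {I : Type*} [Field K] (G : Digraph I) :
    PresAlg (SimpleGraphRel K G) →ₙₐ[K] GraphAlg K G :=
  PresAlg.lift (PresAlg.gen (GraphRel K G)) fun x y h => by
    induction h with
    | zero h =>
      rw [map_mul, map_zero, FreeNU.lift_gen, FreeNU.lift_gen, gen_mul_gen_eq_zero h]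
    | @edge i j k hj hk =>
      rw [map_mul, map_mul, FreeNU.lift_gen, FreeNU.lift_gen, FreeNU.lift_gen]
      exact pathProd_congr (l := [j]) (l' := [k]) rfl (.cons_cons hj (.singleton j))
        (.cons_cons hk (.singleton k))

/-- In a coherent graph, two paths of the same length from `i` are related by changing one vertex
at a time, so the path relations follow from those of length one. -/
theorem simple_pathProd_congr (hG : G.Coherent) {i : I} {l l' : List I}
    (h : l.length = l'.length) (hl : List.IsChain G.Adj (i :: l))
    (hl' : List.IsChain G.Adj (i :: l')) :
    pathProd (PresAlg.gen (SimpleGraphRel K G)) i l =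
      pathProd (PresAlg.gen (SimpleGraphRel K G)) i l' := by
  induction l generalizing i l' with
  | nil => rw [List.length_eq_zero_iff.1 h.symm]
  | cons j l ih =>
    obtain _ | ⟨k, l'⟩ := l'
    · simp at h
    rw [List.isChain_cons_cons] at hl hl'
    have hjk : PresAlg.gen (SimpleGraphRel K G) j * PresAlg.gen (SimpleGraphRel K G) i =
        PresAlg.gen (SimpleGraphRel K G) k * PresAlg.gen (SimpleGraphRel K G) i :=
      (PresAlg.mk_eq_mk _).2 (.of (.edge hl.1 hl'.1))
    have hkl : List.IsChain G.Adj (k :: l) := by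
      obtain _ | ⟨a, l⟩ := l
      · exact .singleton k
      · rw [List.isChain_cons_cons] at hl ⊢
        exact ⟨(hG.2 i j k hl.1 hl'.1 a).1 hl.2.1, hl.2.2⟩
    have hswap : pathProd (PresAlg.gen (SimpleGraphRel K G)) j l *
          PresAlg.gen (SimpleGraphRel K G) i =
        pathProd (PresAlg.gen (SimpleGraphRel K G)) k l * PresAlg.gen (SimpleGraphRel K G) i := by
      cases l with
      | nil => exact hjk
      | cons a l => rw [pathProd, pathProd, mul_assoc, mul_assoc, hjk]
    rw [pathProd, pathProd, hswap, ih (by simpa using h) hkl hl'.2]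

theorem ofSimple_bijective (hG : G.Coherent) : Function.Bijective (ofSimple K G) := by
  let ψ : GraphAlg K G →ₙₐ[K] PresAlg (SimpleGraphRel K G) :=
    PresAlg.lift (PresAlg.gen (SimpleGraphRel K G)) fun x y h => by
      rw [PresAlg.lift_eq_mk, PresAlg.lift_eq_mk]
      induction h with
      | zero h => exact (PresAlg.mk_eq_mk _).2 (.of (.zero h))
      | path h hl hl' =>
        rw [PresAlg.mk_pathProd, PresAlg.mk_pathProd, simple_pathProd_congr hG h hl hl']
  have h1 : ∀ x, ofSimple K G (PresAlg.mk _ x) = PresAlg.mk _ x := PresAlg.lift_eq_mk _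
  have h2 : ∀ x, ψ (PresAlg.mk _ x) = PresAlg.mk _ x := PresAlg.lift_eq_mk _
  refine Function.bijective_iff_has_inverse.2 ⟨ψ, fun x => ?_, fun x => ?_⟩
  · obtain ⟨x, rfl⟩ := PresAlg.mk_surjective _ x
    rw [h1, h2]
  · obtain ⟨x, rfl⟩ := PresAlg.mk_surjective _ x
    rw [h2, h1]

end GraphAlg

/-! ### Grafting and admissible cuts -/

namespace RTree

variable {D : Type*}

/-- The decoration of the root. -/
def root : RTree D → D :=
  Quotient.lift (fun | .node d _ => d) fun t t' h => by
    induction h with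
    | perm => rfl
    | child => rfl
    | symm _ ih => exact ih.symm
    | trans _ _ ih ih' => exact ih.trans ih'

/-- The subtrees attached to the root. -/
def children : RTree D → Multiset (RTree D) :=
  Quotient.lift (fun | .node _ l => ↑(l.map RTree.mk)) fun t t' h => by
    induction h with
    | perm d h => exact Multiset.coe_eq_coe.2 (h.map _)
    | @child d t t' l h _ =>
      have : RTree.mk t = RTree.mk t' := Quotient.sound h
      simp only [List.map_cons, this]
    | symm _ ih => exact ih.symm
    | trans _ _ ih ih' => exact ih.trans ih'

theorem root_graft (d : D) (s : Multiset (RTree D)) : (graft d s).root = d := rfl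

theorem children_graft (d : D) (s : Multiset (RTree D)) : (graft d s).children = s := by
  have h : (graft d s).children = ↑((s.toList.map RTree.out).map RTree.mk) := rfl
  have h' : (RTree.mk ∘ RTree.out : RTree D → RTree D) = id := funext RTree.mk_out
  rw [h, List.map_map, h', List.map_id, Multiset.coe_toList]

theorem graft_inj {d d' : D} {s s' : Multiset (RTree D)} :
    graft d s = graft d' s' ↔ d = d' ∧ s = s' := by
  refine ⟨fun h => ⟨?_, ?_⟩, fun h => by rw [h.1, h.2]⟩
  · rw [← root_graft d s, h, root_graft]
  · rw [← children_graft d s, h, children_graft]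

theorem cuts_graft_zero (d : D) : (graft d 0).cuts = {(0, graft d 0)} := by
  have h : graft d 0 = RTree.mk (.node d []) := graft_coe d []
  rw [h]
  change PTree.cuts (.node d []) = _
  rw [PTree.cuts, PTree.cutsList, Multiset.map_singleton, ← h]

theorem cuts_graft_singleton (d : D) (t : RTree D) :
    (graft d {t}).cuts = ({t}, graft d 0) ::ₘ t.cuts.map fun p => (p.1, graft d {p.2}) := by
  obtain ⟨t, rfl⟩ := RTree.mk_surjective t
  have h : graft d {RTree.mk t} = RTree.mk (.node d [t]) := graft_coe d [t]
  rw [h]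
  change PTree.cuts (.node d [t]) = _ ::ₘ (PTree.cuts t).map _
  rw [PTree.cuts, PTree.cutsList, PTree.cutsList]
  simp only [SProd.sprod, Multiset.product, Multiset.map_singleton, Multiset.bind_singleton,
    Multiset.map_map, Function.comp_def, Multiset.map_cons, Prod.fst_add, Prod.snd_add, add_zero]

/-- The tree without ramification whose decorations, read from the root, are `i` and the elements
of the list. -/
def ladder : D → List D → RTree D
  | i, [] => graft i 0
  | i, j :: l => graft i {ladder j l}

end RTree

namespace TreeAlg

variable {K D : Type*} [Field K]

theorem Bplus_one (d : D) : Bplus K d 1 = MvPolynomial.X (RTree.graft d 0) := by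
  have : (1 : TreeAlg K D) = MvPolynomial.basisMonomials (RTree D) K 0 := by simp
  rw [this, Bplus, Module.Basis.constr_basis, map_zero]

theorem Bplus_X (d : D) (t : RTree D) :
    Bplus K d (MvPolynomial.X t) = MvPolynomial.X (RTree.graft d {t}) := by
  have : (MvPolynomial.X t : TreeAlg K D) =
      MvPolynomial.basisMonomials (RTree D) K (Finsupp.single t 1) := by
    simp [MvPolynomial.X]
  rw [this, Bplus, Module.Basis.constr_basis, Finsupp.toMultiset_single, one_smul]

theorem Bplus_mem_homog (d : D) {n : ℕ} {y : TreeAlg K D} (hy : y ∈ homog K D n) :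
    Bplus K d y ∈ homog K D (n + 1) := by
  rw [y.as_sum, map_sum]
  refine Submodule.sum_mem _ fun m hm => ?_
  have h1 : Finsupp.weight RTree.weight m = n := hy (MvPolynomial.mem_support_iff.1 hm)
  have h2 : MvPolynomial.monomial m (MvPolynomial.coeff m y) =
      MvPolynomial.coeff m y • MvPolynomial.basisMonomials (RTree D) K m := by
    simp [MvPolynomial.smul_monomial]
  have h3 : (RTree.graft d (Finsupp.toMultiset m)).weight = n + 1 := by
    rw [RTree.weight_graft, ← h1, add_comm, Finsupp.weight_apply, Finsupp.toMultiset_map,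
      Finsupp.sum_toMultiset,
      Finsupp.sum_mapDomain_index (h := fun a k => k • a) (fun a => zero_smul ℕ a)
        (fun a b c => add_smul b c a)]
  rw [h2, map_smul, Bplus, Module.Basis.constr_basis, ← h3]
  exact Submodule.smul_mem _ _ (MvPolynomial.isWeightedHomogeneous_X _ _ _)

variable (K D) in
/-- The span of the trees. -/
def linearPart : Submodule K (TreeAlg K D) := Submodule.span K (Set.range MvPolynomial.X)

theorem Bplus_mem_linearPart (d : D) (y : TreeAlg K D) : Bplus K d y ∈ linearPart K D := by
  have h : LinearMap.range (Bplus K d) ≤ linearPart K D := by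
    rw [Bplus, Module.Basis.constr_range]
    refine Submodule.span_mono ?_
    rintro _ ⟨m, rfl⟩
    exact ⟨_, rfl⟩
  exact h ⟨y, rfl⟩

theorem comul_X_graft_zero (d : D) :
    comul K (MvPolynomial.X (RTree.graft d 0)) =
      MvPolynomial.X (RTree.graft d 0) ⊗ₜ[K] 1 + 1 ⊗ₜ[K] MvPolynomial.X (RTree.graft d 0) := by
  rw [comul, MvPolynomial.aeval_X, RTree.cuts_graft_zero]
  simp [forest]

/-- The cocycle property of `B⁺_d`, on the span of the trees. -/
theorem comul_Bplus (d : D) {x : TreeAlg K D} (hx : x ∈ linearPart K D) :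
    comul K (Bplus K d x) =
      Bplus K d x ⊗ₜ[K] 1 + TensorProduct.map LinearMap.id (Bplus K d) (comul K x) := by
  induction hx using Submodule.span_induction with
  | mem x hx =>
    obtain ⟨t, rfl⟩ := hx
    rw [Bplus_X, comul, MvPolynomial.aeval_X, MvPolynomial.aeval_X, RTree.cuts_graft_singleton,
      map_add, TensorProduct.map_tmul, Bplus_one, map_multiset_sum, Multiset.map_map,
      Multiset.map_cons, Multiset.sum_cons, Multiset.map_map]
    simp only [Function.comp_def, TensorProduct.map_tmul, Bplus_X, LinearMap.id_apply]
    simp [forest]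
  | zero => simp
  | add x y _ _ hx hy => simp only [map_add, hx, hy, TensorProduct.add_tmul]; abel
  | smul c x _ hx => simp only [map_smul, hx, smul_add, TensorProduct.smul_tmul']

/-- The linear form giving the coefficient of a tree. -/
def treeCoeff (K : Type*) [Field K] (t : RTree D) : TreeAlg K D →ₗ[K] K :=
  MvPolynomial.lcoeff K (Finsupp.single t 1)

theorem treeCoeff_mul (t : RTree D) (a b : TreeAlg K D) :
    treeCoeff K t (a * b) =
      treeCoeff K t a * counit K b + counit K a * treeCoeff K t b := by
  classical
  have h : ∀ x : TreeAlg K D, treeCoeff K t (proj K x) = treeCoeff K t x := fun x => by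
    change MvPolynomial.coeff (Finsupp.single t 1) (MvPolynomial.homogeneousComponent 1 x) = _
    rw [MvPolynomial.coeff_homogeneousComponent, if_pos (by simp)]
    rfl
  rw [← h (a * b), proj_mul, map_add, map_smul, map_smul, h, h, smul_eq_mul, smul_eq_mul]
  ring

theorem treeCoeff_eq_zero {t : RTree D} {n : ℕ} (hn : t.weight < n) {a : TreeAlg K D}
    (ha : a ∈ homog K D n) : treeCoeff K t a = 0 := by
  by_contra h
  have := ha h
  rw [Finsupp.weight_single, one_smul] at this
  omega

theorem treeCoeff_one (t : RTree D) : treeCoeff K t 1 = 0 := by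
  classical
  change MvPolynomial.coeff (Finsupp.single t 1) (1 : TreeAlg K D) = _
  rw [MvPolynomial.coeff_one, if_neg]
  simp [eq_comm]

theorem treeCoeff_X [DecidableEq (RTree D)] (t u : RTree D) :
    treeCoeff K t (MvPolynomial.X u) = if u = t then 1 else 0 := by
  change MvPolynomial.coeff (Finsupp.single t 1) (MvPolynomial.X u : TreeAlg K D) = _
  rw [MvPolynomial.coeff_X]
  simp only [Finsupp.single_left_inj one_ne_zero]

theorem treeCoeff_graft_zero_Bplus (d e : D)
    {x : TreeAlg K D} (hx : x ∈ linearPart K D) :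
    treeCoeff K (RTree.graft d 0) (Bplus K e x) = 0 := by
  classical
  induction hx using Submodule.span_induction with
  | mem x hx =>
    obtain ⟨u, rfl⟩ := hx
    rw [Bplus_X, treeCoeff_X, if_neg (by simp [RTree.graft_inj])]
  | zero => simp
  | add x y _ _ hx hy => rw [map_add, map_add, hx, hy, add_zero]
  | smul c x _ hx => rw [map_smul, map_smul, hx, smul_zero]

theorem treeCoeff_graft_singleton_Bplus [DecidableEq D] (d e : D) (t : RTree D)
    {x : TreeAlg K D} (hx : x ∈ linearPart K D) :
    treeCoeff K (RTree.graft d {t}) (Bplus K e x) = if d = e then treeCoeff K t x else 0 := by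
  classical
  induction hx using Submodule.span_induction with
  | mem x hx =>
    obtain ⟨u, rfl⟩ := hx
    rw [Bplus_X, treeCoeff_X, treeCoeff_X]
    simp only [RTree.graft_inj, Multiset.singleton_inj, eq_comm (a := e), ite_and]
  | zero => simp
  | add x y _ _ hx hy =>
    rw [map_add, map_add, hx, hy, map_add]
    split_ifs <;> simp
  | smul c x _ hx =>
    rw [map_smul, map_smul, hx, map_smul]
    split_ifs <;> simp

end TreeAlg

/-! ### The system attached to a graph -/

namespace SDSE

open TreeAlg

variable {K I : Type*} [Field K]

theorem IsSolution.coeff_zero {F : I → MvPowerSeries I K} {X : I → PowerSeries (TreeAlg K I)}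
    (hX : IsSolution F X) (i : I) : PowerSeries.coeff 0 (X i) = 0 := by
  rw [hX.eqn i, completedBplus, PowerSeries.coeff_mk]

/-- The component `X_i(n)` as an element of `H_(S)`. -/
def component (X : I → PowerSeries (TreeAlg K I)) (i : I) (n : ℕ) : generated X :=
  ⟨PowerSeries.coeff n (X i), Algebra.subset_adjoin ⟨i, n, rfl⟩⟩

/-- A form on `H_(S)` that satisfies the Leibniz rule for the counit is determined by its values
at the components of the solution. -/
theorem form_ext {X : I → PowerSeries (TreeAlg K I)} {f g : Module.Dual K (generated X)}
    (hf : ∀ a b, f (a * b) =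
      f a * counit K (b : TreeAlg K I) + counit K (a : TreeAlg K I) * f b)
    (hg : ∀ a b, g (a * b) =
      g a * counit K (b : TreeAlg K I) + counit K (a : TreeAlg K I) * g b)
    (h : ∀ i n, f (component X i n) = g (component X i n)) : f = g := by
  have one : ∀ k : Module.Dual K (generated X), (∀ a b, k (a * b) =
      k a * counit K (b : TreeAlg K I) + counit K (a : TreeAlg K I) * k b) → k 1 = 0 :=
    fun k hk => by simpa using hk 1 1
  refine LinearMap.ext fun ⟨x, hx⟩ => ?_
  induction hx using Algebra.adjoin_induction with
  | mem x hx =>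
    obtain ⟨i, n, rfl⟩ := hx
    exact h i n
  | algebraMap c =>
    have e : (⟨algebraMap K _ c, Subalgebra.algebraMap_mem _ c⟩ : generated X) = c • 1 :=
      Subtype.ext (Algebra.algebraMap_eq_smul_one c)
    exact (congrArg f e).trans (Eq.trans (by rw [map_smul, map_smul, one f hf, one g hg])
      (congrArg g e).symm)
  | add x y hx hy ihx ihy =>
    have e : (⟨x + y, Subalgebra.add_mem _ hx hy⟩ : generated X) = ⟨x, hx⟩ + ⟨y, hy⟩ := rfl
    exact (congrArg f e).trans (Eq.trans (by rw [map_add, map_add, ihx, ihy])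
      (congrArg g e).symm)
  | mul x y hx hy ihx ihy =>
    have e : (⟨x * y, Subalgebra.mul_mem _ hx hy⟩ : generated X) = ⟨x, hx⟩ * ⟨y, hy⟩ := rfl
    exact (congrArg f e).trans (Eq.trans (by rw [hf, hg, ihx, ihy]) (congrArg g e).symm)

/-- The form on `H_(S)` giving the coefficient of a tree. -/
def coeffForm (X : I → PowerSeries (TreeAlg K I)) (t : RTree I) : preLieAlgebra X :=
  ⟨treeCoeff K t ∘ₗ (generated X).val.toLinearMap,
    ⟨t.weight + 1, fun _ hn _ ha => treeCoeff_eq_zero (Nat.lt_of_succ_le hn) ha⟩,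
    fun _ _ => treeCoeff_mul t _ _⟩

theorem coeffForm_apply (X : I → PowerSeries (TreeAlg K I)) (t : RTree I) (a : generated X) :
    (coeffForm X t).1 a = treeCoeff K t a := rfl

theorem IsSolution.coeff_mem_linearPart {F : I → MvPowerSeries I K}
    {X : I → PowerSeries (TreeAlg K I)} (hX : IsSolution F X) (i : I) (n : ℕ) :
    PowerSeries.coeff n (X i) ∈ linearPart K I := by
  rw [hX.eqn i, completedBplus, PowerSeries.coeff_mk]
  cases n with
  | zero => exact Submodule.zero_mem _
  | succ n => exact Bplus_mem_linearPart _ _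

theorem projRestrict_component {F : I → MvPowerSeries I K} {X : I → PowerSeries (TreeAlg K I)}
    (hX : IsSolution F X) (i : I) (n : ℕ) :
    projRestrict hX (component X i n) = component X i n :=
  Subtype.ext (hX.proj_coeff i n)

theorem projRestrict_one {F : I → MvPowerSeries I K} {X : I → PowerSeries (TreeAlg K I)}
    (hX : IsSolution F X) : projRestrict hX 1 = 0 := by
  apply Subtype.ext
  change proj K 1 = 0
  simpa using proj_mul (K := K) (1 : TreeAlg K I) 1

theorem component_zero {F : I → MvPowerSeries I K} {X : I → PowerSeries (TreeAlg K I)}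
    (hX : IsSolution F X) (i : I) : component X i 0 = 0 :=
  Subtype.ext (hX.coeff_zero i)

/-- Two elements of `g_(S)` are equal if they agree on the `X_i(n)`, `n ≥ 1`. -/
theorem preLieAlgebra_ext {F : I → MvPowerSeries I K} {X : I → PowerSeries (TreeAlg K I)}
    (hX : IsSolution F X) {f g : preLieAlgebra X}
    (h : ∀ i n, f.1 (component X i (n + 1)) = g.1 (component X i (n + 1))) : f = g := by
  refine Subtype.ext (form_ext f.2.2 g.2.2 fun i n => ?_)
  cases n with
  | zero => rw [component_zero hX, map_zero, map_zero]
  | succ n => exact h i n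

theorem preLieProd_add_left {F : I → MvPowerSeries I K} {X : I → PowerSeries (TreeAlg K I)}
    (hX : IsSolution F X) (hA : IsHopfSubalgebra (generated X)) (f f' g : preLieAlgebra X) :
    preLieProd hX hA (f + f') g = preLieProd hX hA f g + preLieProd hX hA f' g := by
  apply Subtype.ext
  simp only [preLieProd, preLieForm, Submodule.coe_add, LinearMap.add_comp,
    TensorProduct.map_add_left, LinearMap.comp_add]

theorem preLieProd_add_right {F : I → MvPowerSeries I K} {X : I → PowerSeries (TreeAlg K I)}
    (hX : IsSolution F X) (hA : IsHopfSubalgebra (generated X)) (f g g' : preLieAlgebra X) :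
    preLieProd hX hA f (g + g') = preLieProd hX hA f g + preLieProd hX hA f g' := by
  apply Subtype.ext
  simp only [preLieProd, preLieForm, Submodule.coe_add, LinearMap.add_comp,
    TensorProduct.map_add_right, LinearMap.comp_add]

theorem preLieProd_smul_left {F : I → MvPowerSeries I K} {X : I → PowerSeries (TreeAlg K I)}
    (hX : IsSolution F X) (hA : IsHopfSubalgebra (generated X)) (c : K) (f g : preLieAlgebra X) :
    preLieProd hX hA (c • f) g = c • preLieProd hX hA f g := by
  apply Subtype.ext
  simp only [preLieProd, preLieForm, Submodule.coe_smul, LinearMap.smul_comp,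
    TensorProduct.map_smul_left, LinearMap.comp_smul]

theorem preLieProd_smul_right {F : I → MvPowerSeries I K} {X : I → PowerSeries (TreeAlg K I)}
    (hX : IsSolution F X) (hA : IsHopfSubalgebra (generated X)) (c : K) (f g : preLieAlgebra X) :
    preLieProd hX hA f (c • g) = c • preLieProd hX hA f g := by
  apply Subtype.ext
  simp only [preLieProd, preLieForm, Submodule.coe_smul, LinearMap.smul_comp,
    TensorProduct.map_smul_right, LinearMap.comp_smul]

variable [Fintype I] {G : Digraph I}

open Classical in
theorem coeff_subst_graphSeries {X : I → PowerSeries (TreeAlg K I)}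
    (h : ∀ i, PowerSeries.coeff 0 (X i) = 0) (i : I) (n : ℕ) :
    PowerSeries.coeff n (MvPowerSeries.subst X (graphSeries K G i)) =
      (if n = 0 then 1 else 0) + ∑ j with G.Adj i j, PowerSeries.coeff n (X j) := by
  have hs : MvPowerSeries.HasSubst X := MvPowerSeries.hasSubst_of_constantCoeff_zero fun j => by
    rw [← h j, PowerSeries.coeff_zero_eq_constantCoeff]
    rfl
  rw [← MvPowerSeries.substAlgHom_apply hs, graphSeries, map_add, map_one, map_sum]
  simp only [MvPowerSeries.substAlgHom_X]
  -- The sum is one of `MvPowerSeries Unit _`, to be read as one of `PowerSeries _`.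
  erw [map_add, PowerSeries.coeff_one, map_sum]

open Classical in
theorem IsSolution.coeff_succ {X : I → PowerSeries (TreeAlg K I)}
    (hX : IsSolution (graphSeries K G) X) (i : I) (n : ℕ) :
    PowerSeries.coeff (n + 1) (X i) =
      Bplus K i ((if n = 0 then 1 else 0) + ∑ j with G.Adj i j, PowerSeries.coeff n (X j)) := by
  rw [← coeff_subst_graphSeries hX.coeff_zero, hX.eqn i, completedBplus, PowerSeries.coeff_mk]

theorem IsSolution.coeff_one {X : I → PowerSeries (TreeAlg K I)}
    (hX : IsSolution (graphSeries K G) X) (i : I) :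
    PowerSeries.coeff 1 (X i) = MvPolynomial.X (RTree.graft i 0) := by
  rw [hX.coeff_succ]
  simp [hX.coeff_zero, Bplus_one]

open Classical in
theorem IsSolution.coeff_succ_succ {X : I → PowerSeries (TreeAlg K I)}
    (hX : IsSolution (graphSeries K G) X) (i : I) (n : ℕ) :
    PowerSeries.coeff (n + 2) (X i) =
      ∑ j with G.Adj i j, Bplus K i (PowerSeries.coeff (n + 1) (X j)) := by
  rw [hX.coeff_succ, if_neg n.succ_ne_zero, zero_add, map_sum]

open Classical in
/-- The components of the solution of the system attached to a graph. -/
def graphSolutionCoeff (K : Type*) [Field K] (G : Digraph I) : ℕ → I → TreeAlg K I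
  | 0, _ => 0
  | n + 1, i => Bplus K i ((if n = 0 then 1 else 0) +
      ∑ j with G.Adj i j, graphSolutionCoeff K G n j)

theorem graphSolutionCoeff_mem_homog (n : ℕ) (i : I) :
    graphSolutionCoeff K G n i ∈ homog K I n := by
  classical
  induction n generalizing i with
  | zero => exact Submodule.zero_mem _
  | succ n ih =>
    refine Bplus_mem_homog i (Submodule.add_mem _ ?_ (Submodule.sum_mem _ fun j _ => ih j))
    split_ifs with h
    · rw [h]
      exact MvPolynomial.isWeightedHomogeneous_one _ _
    · exact Submodule.zero_mem _

theorem isSolution_graphSolution :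
    IsSolution (graphSeries K G) fun i => PowerSeries.mk fun n => graphSolutionCoeff K G n i where
  mem_homog i n := by
    rw [PowerSeries.coeff_mk]
    exact graphSolutionCoeff_mem_homog n i
  eqn i := by
    ext1 n
    rw [completedBplus, PowerSeries.coeff_mk, PowerSeries.coeff_mk]
    cases n with
    | zero => rfl
    | succ n =>
      dsimp only
      rw [coeff_subst_graphSeries fun j => by rw [PowerSeries.coeff_mk]; rfl]
      simp only [PowerSeries.coeff_mk]
      rfl

open Classical in
/-- The component `X_i(n)` is the sum of the ladders that are read along the paths with `n`
vertices starting at `i`. -/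
theorem IsSolution.treeCoeff_ladder {X : I → PowerSeries (TreeAlg K I)}
    (hX : IsSolution (graphSeries K G) X) (i a : I) (l : List I) (n : ℕ) :
    treeCoeff K (RTree.ladder a l) (PowerSeries.coeff n (X i)) =
      if a = i ∧ l.length + 1 = n ∧ List.IsChain G.Adj (a :: l) then 1 else 0 := by
  induction l generalizing a i n with
  | nil =>
    obtain _ | _ | n := n
    · simp [hX.coeff_zero]
    · rw [zero_add, hX.coeff_one, treeCoeff_X, RTree.ladder]
      simp [RTree.graft_inj, eq_comm]
    · rw [hX.coeff_succ_succ, map_sum, RTree.ladder]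
      simp [treeCoeff_graft_zero_Bplus _ _ (hX.coeff_mem_linearPart _ _)]
  | cons b l ih =>
    obtain _ | _ | n := n
    · simp [hX.coeff_zero]
    · rw [zero_add, hX.coeff_one, treeCoeff_X, RTree.ladder]
      simp [RTree.graft_inj]
    · rw [hX.coeff_succ_succ, map_sum, RTree.ladder]
      simp only [treeCoeff_graft_singleton_Bplus _ _ _ (hX.coeff_mem_linearPart _ _), ih,
        List.length_cons, List.isChain_cons_cons, Nat.add_right_cancel_iff]
      by_cases hai : a = i
      · subst hai
        by_cases hab : G.Adj a b
        · by_cases h : l.length = n ∧ List.IsChain G.Adj (b :: l)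
          · simp [h, hab, Finset.sum_ite_eq]
          · simp [h, hab]
        · simp only [hab, if_true, false_and, and_false, if_false]
          refine Finset.sum_eq_zero fun j hj => if_neg ?_
          rintro ⟨rfl, -⟩
          exact hab (Finset.mem_filter.1 hj).2
      · simp [hai]

end SDSE

namespace SDSE

open TreeAlg

variable {K I : Type*} [Field K] [Fintype I] {G : Digraph I}

/-! ### The Hopf condition and coherence -/

theorem nonConstant_graphSeries_iff :
    NonConstant (graphSeries K G) ↔ ∀ i, ∃ j, G.Adj i j := by
  classical
  refine forall_congr' fun i => ⟨fun h => ?_, fun ⟨j, hj⟩ c h => ?_⟩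
  · by_contra! hi
    apply h 1
    rw [graphSeries, Finset.sum_eq_zero fun j hj => absurd (Finset.mem_filter.1 hj).2 (hi j),
      add_zero, map_one]
  · have := congrArg (MvPowerSeries.coeff (Finsupp.single j 1)) h
    simp [graphSeries, MvPowerSeries.coeff_X, MvPowerSeries.coeff_C, MvPowerSeries.coeff_one,
      Finsupp.single_left_inj, Finset.sum_ite_eq, hj] at this

theorem IsSolution.comul_coeff_one {X : I → PowerSeries (TreeAlg K I)}
    (hX : IsSolution (graphSeries K G) X) (i : I) :
    comul K (PowerSeries.coeff 1 (X i)) =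
      PowerSeries.coeff 1 (X i) ⊗ₜ[K] 1 + 1 ⊗ₜ[K] PowerSeries.coeff 1 (X i) := by
  rw [hX.coeff_one, comul_X_graft_zero]

open Classical in
theorem IsSolution.comul_coeff_succ_succ {X : I → PowerSeries (TreeAlg K I)}
    (hX : IsSolution (graphSeries K G) X) (i : I) (n : ℕ) :
    comul K (PowerSeries.coeff (n + 2) (X i)) =
      PowerSeries.coeff (n + 2) (X i) ⊗ₜ[K] 1 +
        ∑ j with G.Adj i j, TensorProduct.map LinearMap.id (Bplus K i)
          (comul K (PowerSeries.coeff (n + 1) (X j))) := by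
  rw [hX.coeff_succ_succ, map_sum]
  simp only [comul_Bplus _ (hX.coeff_mem_linearPart _ _), Finset.sum_add_distrib,
    TensorProduct.sum_tmul]

/-- Let `i → j` and `i → k`. On `H_(S)`, the coefficients of the ladders `(i, j)` and `(i, k)`
coincide. Their values on the right factor of `Δ(X_i(3))`, composed with the coefficient of the
one-vertex tree decorated by `l` on the left factor, tell whether `j → l` and whether `k → l`. -/
theorem adj_iff_of_isHopfSubalgebra {X : I → PowerSeries (TreeAlg K I)}
    (hX : IsSolution (graphSeries K G) X) (hA : IsHopfSubalgebra (generated X)) {i j k : I}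
    (hj : G.Adj i j) (hk : G.Adj i k) (l : I) : G.Adj j l ↔ G.Adj k l := by
  classical
  let T : I → TreeAlg K I ⊗[K] TreeAlg K I →ₗ[K] K := fun a =>
    LinearMap.mul' K K ∘ₗ TensorProduct.map (treeCoeff K (RTree.ladder l []))
      (treeCoeff K (RTree.ladder i [a]))
  have hform : coeffForm X (RTree.ladder i [j]) = coeffForm X (RTree.ladder i [k]) := by
    refine Subtype.ext (form_ext (coeffForm X _).2.2 (coeffForm X _).2.2 fun a n => ?_)
    rw [coeffForm_apply, coeffForm_apply, component, hX.treeCoeff_ladder, hX.treeCoeff_ladder]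
    simp [hj, hk]
  have hT : ∀ y : generated X ⊗[K] generated X,
      T j (Algebra.TensorProduct.map (generated X).val (generated X).val y) =
        T k (Algebra.TensorProduct.map (generated X).val (generated X).val y) := by
    intro y
    induction y using TensorProduct.induction_on with
    | zero => simp
    | add x y hx hy => simp only [map_add, hx, hy]
    | tmul x y =>
      have := LinearMap.congr_fun (congrArg Subtype.val hform) y
      rw [coeffForm_apply, coeffForm_apply] at this
      simp only [T, LinearMap.comp_apply, Algebra.TensorProduct.map_tmul, TensorProduct.map_tmul,
        LinearMap.mul'_apply, Subalgebra.val_apply, this]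
  have hval : ∀ a, G.Adj i a →
      T a (comul K (PowerSeries.coeff 3 (X i))) = if G.Adj a l then 1 else 0 := by
    intro a ha
    have h1 : ∀ b n, treeCoeff K (RTree.ladder l []) (PowerSeries.coeff n (X b)) =
        if l = b ∧ n = 1 then 1 else 0 := fun b n => by
      rw [hX.treeCoeff_ladder]
      simp [eq_comm]
    have h2 : ∀ b, treeCoeff K (RTree.ladder i [a])
        (Bplus K i (Bplus K b 1)) = if a = b then 1 else 0 := fun b => by
      rw [Bplus_one, Bplus_X, treeCoeff_X]
      simp [RTree.ladder, RTree.graft_inj, eq_comm]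
    have h3 : ∀ b c, treeCoeff K (RTree.ladder i [a])
        (Bplus K i (Bplus K b (PowerSeries.coeff 1 (X c)))) = 0 := fun b c => by
      rw [hX.coeff_one, Bplus_X, Bplus_X, treeCoeff_X]
      simp [RTree.ladder, RTree.graft_inj]
    have h4 : treeCoeff K (RTree.ladder i [a]) (Bplus K i 1) = 0 := by
      rw [Bplus_one, treeCoeff_X]
      simp [RTree.ladder, RTree.graft_inj]
    rw [hX.comul_coeff_succ_succ i 1]
    simp only [hX.comul_coeff_succ_succ _ 0, zero_add, hX.comul_coeff_one, map_add, map_sum,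
      TensorProduct.map_tmul, LinearMap.id_apply, T, LinearMap.comp_apply, LinearMap.mul'_apply,
      treeCoeff_one, h1, h2, h3, h4]
    simp [Finset.sum_ite_eq, ha]
  obtain ⟨y, hy⟩ := hA ⟨PowerSeries.coeff 3 (X i), Algebra.subset_adjoin ⟨i, 3, rfl⟩, rfl⟩
  have hy' : Algebra.TensorProduct.map (generated X).val (generated X).val y =
      comul K (PowerSeries.coeff 3 (X i)) := hy
  have := hT y
  rw [hy', hval j hj, hval k hk] at this
  by_cases h1 : G.Adj j l <;> by_cases h2 : G.Adj k l <;> simp_all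

open Classical in
/-- The coproduct of `X_i(n + 1)` for a coherent graph. Every path with `p + 1` edges starting
at `i` may be prolonged by the same paths, so cutting the ladders above their vertex of depth `p`
gives the tensor product of the sum of the `X_l(n - p)`, over the ends `l` of the paths with
`p + 1` edges, and of `X_i(p + 1)`. -/
def componentComul (G : Digraph I) (X : I → PowerSeries (TreeAlg K I)) (i : I) (n : ℕ) :
    generated X ⊗[K] generated X :=
  component X i (n + 1) ⊗ₜ[K] 1 + 1 ⊗ₜ[K] component X i (n + 1) +
    ∑ p ∈ Finset.range n,
      (∑ l with HasPath G (p + 1) i l, component X l (n - p)) ⊗ₜ[K] component X i (p + 1)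

theorem map_componentComul (hG : G.Coherent) {X : I → PowerSeries (TreeAlg K I)}
    (hX : IsSolution (graphSeries K G) X) (i : I) (n : ℕ) :
    Algebra.TensorProduct.map (generated X).val (generated X).val (componentComul G X i n) =
      comul K (PowerSeries.coeff (n + 1) (X i)) := by
  classical
  have hexp : ∀ i n,
      Algebra.TensorProduct.map (generated X).val (generated X).val (componentComul G X i n) =
        PowerSeries.coeff (n + 1) (X i) ⊗ₜ[K] 1 + 1 ⊗ₜ[K] PowerSeries.coeff (n + 1) (X i) +
          ∑ p ∈ Finset.range n, (∑ l with HasPath G (p + 1) i l, PowerSeries.coeff (n - p) (X l))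
            ⊗ₜ[K] PowerSeries.coeff (p + 1) (X i) := by
    intro i n
    simp only [componentComul, map_add, map_sum, map_one, Algebra.TensorProduct.map_tmul,
      Subalgebra.val_apply, component]
  rw [hexp]
  induction n generalizing i with
  | zero => rw [hX.comul_coeff_one, Finset.sum_range_zero, add_zero]
  | succ n ih =>
    have hpath : ∀ p, ∀ j ∈ Finset.univ.filter (G.Adj i),
        (∑ l with HasPath G (p + 1) j l, PowerSeries.coeff (n - p) (X l)) =
          ∑ l with HasPath G (p + 2) i l, PowerSeries.coeff (n - p) (X l) := by
      intro p j hj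
      have hj : G.Adj i j := (Finset.mem_filter.1 hj).2
      refine Finset.sum_congr (Finset.filter_congr fun l _ => ⟨fun h => ⟨j, hj, h⟩, ?_⟩)
        fun _ _ => rfl
      rintro ⟨k, hk, h⟩
      exact (hG.hasPath_congr hj hk p).2 h
    have hterm : ∀ p,
        (∑ j with G.Adj i j, (∑ l with HasPath G (p + 1) j l, PowerSeries.coeff (n - p) (X l))
          ⊗ₜ[K] Bplus K i (PowerSeries.coeff (p + 1) (X j))) =
        (∑ l with HasPath G (p + 2) i l, PowerSeries.coeff (n - p) (X l))
          ⊗ₜ[K] PowerSeries.coeff (p + 2) (X i) := by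
      intro p
      rw [hX.coeff_succ_succ, TensorProduct.tmul_sum]
      exact Finset.sum_congr rfl fun j hj => by rw [hpath p j hj]
    rw [hX.comul_coeff_succ_succ]
    simp only [← ih, map_add, map_sum, TensorProduct.map_tmul, LinearMap.id_apply,
      Finset.sum_add_distrib]
    rw [Finset.sum_comm, Finset.sum_congr rfl fun p _ => hterm p, Finset.sum_range_succ',
      ← TensorProduct.tmul_sum, ← TensorProduct.sum_tmul, ← hX.coeff_succ_succ, Bplus_one,
      ← hX.coeff_one]
    simp only [Nat.add_sub_add_right, HasPath, exists_eq_right, zero_add, tsub_zero]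
    abel

theorem isHopfSubalgebra_of_coherent (hG : G.Coherent) {X : I → PowerSeries (TreeAlg K I)}
    (hX : IsSolution (graphSeries K G) X) : IsHopfSubalgebra (generated X) := by
  rw [IsHopfSubalgebra, generated, AlgHom.map_adjoin, Algebra.adjoin_le_iff]
  rintro _ ⟨_, ⟨i, n, rfl⟩, rfl⟩
  cases n with
  | zero =>
    rw [hX.coeff_zero]
    exact (map_zero (comul K)).symm ▸ Subalgebra.zero_mem _
  | succ n => exact ⟨componentComul G X i n, map_componentComul hG hX i n⟩

theorem isHopf_graphSeries_iff : IsHopf (graphSeries K G) ↔ G.Coherent := by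
  rw [IsHopf, nonConstant_graphSeries_iff]
  constructor
  · rintro ⟨h, X, hX, hA⟩
    exact ⟨h, fun i j k hj hk l => adj_iff_of_isHopfSubalgebra hX hA hj hk l⟩
  · exact fun hG => ⟨hG.1, _, isSolution_graphSolution,
      isHopfSubalgebra_of_coherent hG isSolution_graphSolution⟩

/-! ### The pre-Lie algebra of a coherent graph -/

theorem comulRestrict_component (hG : G.Coherent) {X : I → PowerSeries (TreeAlg K I)}
    (hX : IsSolution (graphSeries K G) X) (hA : IsHopfSubalgebra (generated X)) (i : I) (n : ℕ) :
    comulRestrict (generated X) hA (component X i (n + 1)) = componentComul G X i n :=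
  tensor_val_injective _ ((comulRestrict_spec _ hA _).trans (map_componentComul hG hX i n).symm)

open Classical in
theorem preLieProd_component (hG : G.Coherent) {X : I → PowerSeries (TreeAlg K I)}
    (hX : IsSolution (graphSeries K G) X) (hA : IsHopfSubalgebra (generated X))
    (f g : preLieAlgebra X) (i : I) (n : ℕ) :
    (preLieProd hX hA f g).1 (component X i (n + 1)) =
      ∑ p ∈ Finset.range n, (∑ l with HasPath G (p + 1) i l, f.1 (component X l (n - p))) *
        g.1 (component X i (p + 1)) := by
  simp only [preLieProd, preLieForm, LinearMap.comp_apply, projRestrict_component,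
    comulRestrict_component hG hX, componentComul, map_add, map_sum, TensorProduct.map_tmul,
    LinearMap.mul'_apply, projRestrict_one, map_zero, mul_zero, zero_mul, zero_add]

/-- The form dual to `X_i(n)`: the coefficient of the ladder read along a path with `n` vertices
starting at `i`. -/
def dualForm (hG : G.Coherent) (X : I → PowerSeries (TreeAlg K I)) (p : I × ℕ+) :
    preLieAlgebra X :=
  coeffForm X (RTree.ladder p.1 (hG.exists_isChain p.1 (p.2 - 1)).choose)

open Classical in
theorem dualForm_component (hG : G.Coherent) {X : I → PowerSeries (TreeAlg K I)}
    (hX : IsSolution (graphSeries K G) X) (p : I × ℕ+) (i : I) (n : ℕ) :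
    (dualForm hG X p).1 (component X i n) = if p.1 = i ∧ (p.2 : ℕ) = n then 1 else 0 := by
  have h := (hG.exists_isChain p.1 (p.2 - 1)).choose_spec
  have hp : (p.2 : ℕ) - 1 + 1 = p.2 := Nat.sub_add_cancel p.2.pos
  rw [dualForm, coeffForm_apply, component, hX.treeCoeff_ladder, h.1, hp]
  simp [h.2]

open Classical in
theorem dualForm_component_mk (hG : G.Coherent) {X : I → PowerSeries (TreeAlg K I)}
    (hX : IsSolution (graphSeries K G) X) (a : I) (m : ℕ+) (i : I) (n : ℕ) :
    (dualForm hG X (a, m)).1 (component X i n) = if a = i ∧ (m : ℕ) = n then 1 else 0 :=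
  dualForm_component hG hX (a, m) i n

theorem linearIndependent_dualForm (hG : G.Coherent) {X : I → PowerSeries (TreeAlg K I)}
    (hX : IsSolution (graphSeries K G) X) : LinearIndependent K (dualForm hG X) := by
  classical
  let ev : preLieAlgebra X →ₗ[K] I × ℕ+ → K :=
    LinearMap.pi fun p => LinearMap.applyₗ (component X p.1 p.2) ∘ₗ (preLieAlgebra X).subtype
  have h : ev ∘ dualForm hG X = fun p => Pi.single p 1 := by
    funext p q
    change (dualForm hG X p).1 (component X q.1 q.2) = _
    rw [dualForm_component hG hX]
    simp only [PNat.coe_inj, ← Prod.ext_iff, Pi.single_apply, eq_comm]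
  refine LinearIndependent.of_comp ev ?_
  rw [h]
  exact Pi.linearIndependent_single_one (I × ℕ+) K

theorem span_dualForm (hG : G.Coherent) {X : I → PowerSeries (TreeAlg K I)}
    (hX : IsSolution (graphSeries K G) X) : ⊤ ≤ Submodule.span K (Set.range (dualForm hG X)) := by
  classical
  rintro f -
  obtain ⟨N, hN⟩ := f.2.1
  have hf : f = ∑ i, ∑ m ∈ Finset.range N,
      f.1 (component X i (m + 1)) • dualForm hG X (i, m.succPNat) := by
    refine preLieAlgebra_ext hX fun k n => ?_
    simp only [Submodule.coe_sum, Submodule.coe_smul, LinearMap.sum_apply, LinearMap.smul_apply,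
      dualForm_component hG hX, Nat.succPNat_coe, smul_eq_mul, mul_ite, mul_one, mul_zero,
      Nat.succ_eq_add_one, Nat.add_right_cancel_iff]
    rw [Finset.sum_eq_single k (fun i _ hi => Finset.sum_eq_zero fun m _ => if_neg (by tauto))
      (by simp)]
    simp only [true_and, Finset.sum_ite_eq', Finset.mem_range]
    split_ifs with h
    · rfl
    · exact hN (n + 1) (by omega) _ (hX.mem_homog k (n + 1))
  rw [hf]
  exact Submodule.sum_mem _ fun i _ => Submodule.sum_mem _ fun m _ =>
    Submodule.smul_mem _ _ (Submodule.subset_span ⟨_, rfl⟩)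

open Classical in
theorem preLieProd_dualForm (hG : G.Coherent) {X : I → PowerSeries (TreeAlg K I)}
    (hX : IsSolution (graphSeries K G) X) (hA : IsHopfSubalgebra (generated X)) (i j : I)
    (m n : ℕ+) :
    preLieProd hX hA (dualForm hG X (j, n)) (dualForm hG X (i, m)) =
      if HasPath G m i j then dualForm hG X (i, m + n) else 0 := by
  refine preLieAlgebra_ext hX fun k N => ?_
  obtain ⟨a, ha⟩ : ∃ a : ℕ, (m : ℕ) = a + 1 := Nat.exists_eq_add_of_le' m.pos
  have hn := n.pos
  have hrhs : (if HasPath G m i j then dualForm hG X (i, m + n) else 0).1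
        (component X k (N + 1)) =
      if HasPath G m i j ∧ i = k ∧ (m + n : ℕ) = N + 1 then 1 else 0 := by
    by_cases h : HasPath G m i j
    · rw [if_pos h, dualForm_component_mk hG hX]
      simp only [PNat.add_coe, h, true_and]
      congr
    · rw [if_neg h, if_neg fun h' => h h'.1]
      rfl
  rw [preLieProd_component hG, hrhs]
  simp only [dualForm_component_mk hG hX]
  split_ifs with h
  · obtain ⟨h, rfl, hN⟩ := h
    rw [Finset.sum_eq_single a]
    · rw [← ha, if_pos ⟨rfl, rfl⟩, mul_one, Finset.sum_eq_single j]
      · exact if_pos ⟨rfl, by omega⟩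
      · exact fun l _ hl => if_neg fun h' => hl h'.1.symm
      · exact fun h' => absurd (Finset.mem_filter.2 ⟨Finset.mem_univ j, h⟩) h'
    · intro p _ hp
      rw [if_neg fun h' => hp (by omega), mul_zero]
    · exact fun h' => absurd (Finset.mem_range.2 (by omega)) h'
  · refine Finset.sum_eq_zero fun p hp => ?_
    rw [Finset.mem_range] at hp
    by_cases hip : i = k ∧ (m : ℕ) = p + 1
    · obtain ⟨rfl, hp'⟩ := hip
      rw [Finset.sum_eq_zero, zero_mul]
      refine fun l hl => if_neg ?_
      rintro ⟨rfl, hN⟩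
      exact h ⟨hp' ▸ (Finset.mem_filter.1 hl).2, rfl, by omega⟩
    · rw [if_neg hip, mul_zero]

/-- The bases of `A_G` and of `g_(S)` multiply in the same way. -/
theorem exists_equiv_preLieAlgebra (hG : G.Coherent) {X : I → PowerSeries (TreeAlg K I)}
    (hX : IsSolution (graphSeries K G) X) (hA : IsHopfSubalgebra (generated X)) :
    ∃ e : GraphAlg K G ≃ₗ[K] preLieAlgebra X,
      ∀ x y, e (x * y) = preLieProd hX hA (e x) (e y) := by
  classical
  let b := Module.Basis.mk (GraphAlg.linearIndependent_P (K := K) hG)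
    (GraphAlg.span_P_eq_top hG).ge
  let b' := Module.Basis.mk (linearIndependent_dualForm hG hX) (span_dualForm hG hX)
  have he : ∀ (i : I) (n : ℕ+), b.equiv b' (Equiv.refl _) (GraphAlg.P K G i n) =
      dualForm hG X (i, n) := by
    intro i n
    have h1 : b (i, n) = GraphAlg.P K G i n := Module.Basis.mk_apply _ _ _
    have h2 : b' (i, n) = dualForm hG X (i, n) := Module.Basis.mk_apply _ _ _
    rw [← h1, ← h2, Module.Basis.equiv_apply, Equiv.refl_apply]
  have hspan : ∀ x : GraphAlg K G,
      x ∈ Submodule.span K (Set.range fun p : I × ℕ+ => GraphAlg.P K G p.1 p.2) := fun x => by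
    rw [GraphAlg.span_P_eq_top hG]
    trivial
  refine ⟨b.equiv b' (Equiv.refl _), fun x y => ?_⟩
  have zero_left : ∀ g, preLieProd hX hA 0 g = 0 := fun g => by
    simpa using preLieProd_smul_left hX hA 0 0 g
  have zero_right : ∀ f, preLieProd hX hA f 0 = 0 := fun f => by
    simpa using preLieProd_smul_right hX hA 0 f 0
  induction hspan x using Submodule.span_induction with
  | zero => rw [zero_mul, map_zero, zero_left]
  | add x x' _ _ hx hx' => rw [add_mul, map_add, map_add, preLieProd_add_left, hx, hx']
  | smul c x _ hx => rw [smul_mul_assoc, map_smul, map_smul, preLieProd_smul_left, hx]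
  | mem x hx =>
    obtain ⟨⟨j, n⟩, rfl⟩ := hx
    induction hspan y using Submodule.span_induction with
    | zero => rw [mul_zero, map_zero, zero_right]
    | add y y' _ _ hy hy' => rw [mul_add, map_add, map_add, preLieProd_add_right, hy, hy']
    | smul c y _ hy => rw [mul_smul_comm, map_smul, map_smul, preLieProd_smul_right, hy]
    | mem y hy =>
      obtain ⟨⟨i, m⟩, rfl⟩ := hy
      have h := GraphAlg.P_mul_P (K := K) hG (i := i) (j := j) (m := m) (n := n) m.pos n.pos
      dsimp only
      rw [he, he, preLieProd_dualForm]
      split_ifs with hp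
      · rw [h.1 hp, ← PNat.add_coe, he]
      · rw [h.2 hp, map_zero]

end SDSE

theorem proposition57 {K I : Type*} [Field K] [CharZero K] [Fintype I] [Nonempty I]
    (G : Digraph I) :
    List.TFAE [
      LinearIndependent K (fun p : I × ℕ+ => GraphAlg.P K G p.1 p.2) ∧
        Submodule.span K (Set.range fun p : I × ℕ+ => GraphAlg.P K G p.1 p.2) = ⊤,
      ∀ (i : I) (n : ℕ), 1 ≤ n → GraphAlg.P K G i n ≠ 0,
      (∀ i, ∃ j, G.Adj i j) ∧
        ∀ i j k, G.Adj i j → G.Adj i k → ∀ l, G.Adj j l ↔ G.Adj k l,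
      SDSE.IsHopf (SDSE.graphSeries K G)] ∧
    (((∀ i, ∃ j, G.Adj i j) ∧
        ∀ i j k, G.Adj i j → G.Adj i k → ∀ l, G.Adj j l ↔ G.Adj k l) →
      (∃ φ : PresAlg (SimpleGraphRel K G) →ₙₐ[K] GraphAlg K G,
        Function.Bijective φ ∧
          ∀ i, φ (PresAlg.gen (SimpleGraphRel K G) i) = PresAlg.gen (GraphRel K G) i) ∧
      (∀ (i j : I) (m n : ℕ), 1 ≤ m → 1 ≤ n →
        (HasPath G m i j →
          GraphAlg.P K G j n * GraphAlg.P K G i m = GraphAlg.P K G i (m + n)) ∧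
        (¬ HasPath G m i j → GraphAlg.P K G j n * GraphAlg.P K G i m = 0)) ∧
      ∀ (X : I → PowerSeries (TreeAlg K I))
        (hX : SDSE.IsSolution (SDSE.graphSeries K G) X)
        (hA : TreeAlg.IsHopfSubalgebra (SDSE.generated X)),
        (∀ f g h : SDSE.preLieAlgebra X,
          SDSE.preLieProd hX hA (SDSE.preLieProd hX hA f g) h =
            SDSE.preLieProd hX hA f (SDSE.preLieProd hX hA g h)) ∧
        ∃ e : GraphAlg K G ≃ₗ[K] SDSE.preLieAlgebra X,
          ∀ x y, e (x * y) = SDSE.preLieProd hX hA (e x) (e y)) := by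
  constructor
  · tfae_have 1 → 2 := fun h i n hn => h.1.ne_zero (i, (⟨n, hn⟩ : ℕ+))
    tfae_have 2 → 3 := GraphAlg.coherent_of_P_ne_zero
    tfae_have 3 → 1 := fun h => ⟨GraphAlg.linearIndependent_P h, GraphAlg.span_P_eq_top h⟩
    tfae_have 4 ↔ 3 := SDSE.isHopf_graphSeries_iff
    tfae_finish
  · intro (hG : G.Coherent)
    refine ⟨⟨GraphAlg.ofSimple K G, GraphAlg.ofSimple_bijective hG, PresAlg.lift_gen _ _⟩,
      fun i j m n hm hn => GraphAlg.P_mul_P hG hm hn, fun X hX hA => ?_⟩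
    obtain ⟨e, he⟩ := SDSE.exists_equiv_preLieAlgebra hG hX hA
    refine ⟨fun f g h => ?_, e, he⟩
    obtain ⟨f, rfl⟩ := e.surjective f
    obtain ⟨g, rfl⟩ := e.surjective g
    obtain ⟨h, rfl⟩ := e.surjective h
    rw [← he, ← he, ← he, ← he, mul_assoc]

end
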